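/- **Setting.** Let $K$ be a field, $n\ge 0$, $T=K\langle x_1,\dots,x_n\rangle$ the free associative algebra, and let $K[\underline x]\subseteq T$ be the subspace spanned by the standard monomials $\underline x^\alpha=x_1^{\alpha_1}\cdots x_n^{\alpha_n}$, $\alpha\in\mathbb N^n$. For a finite set $E$, a *monomial ordering* on the standard monomials $\underline x^\alpha(e)$ of $T^E$ (identified with pairs $(\alpha,e)\in\mathbb N^n\times E$) is a total order $\prec^E$ such that $(\alpha,e)\prec^E(\alpha',e')$ implies $(\alpha+\gamma,e)\prec^E(\alpha'+\gamma,e')$ for all $\gamma\in\mathbb N^n$; it is a *well-ordering* if $(0,e)\preceq^E(\alpha,e)$ always. It induces orderings $\prec_e$ on $\mathbb N^n$ by $\alpha\prec_e\beta\Leftrightarrow(\alpha,e)\prec^E(\beta,e)$. An ordering $\prec$ on standard monomials of $T$ is extended to all words in $x_1,\dots,x_n$ by comparing first the exponent vectors, then the lengths, then lexicographically. Leading monomials $\operatorname{lm}$, leading coefficients $\operatorname{lc}$, leading exponents $\operatorname{le}$, leading components $\operatorname{lcomp}$ and extended leading exponents $\operatorname{lec}=(\operatorname{le},\operatorname{lcomp})$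 are taken with respect to these orderings; $\operatorname{le}(0)$ and $\operatorname{lec}(0)$ are a symbol $\bot$ smaller than everything else, and a sum with a summand $\bot$ is $\bot$. For a set $G$, $\operatorname{l}(G)=\{\operatorname{lec}(g)\mid 0\ne g\in G\}$ and $\operatorname{L}(G)=\mathbb N^n+\operatorname{l}(G)$, where $\beta+(\alpha,e)=(\beta+\alpha,e)$ (for subsets of $T$, the component is omitted). For $S\subseteq T$, a *reduction* with respect to $(S,\prec)$ is a $K$-linear map $T\to T$ which, for some $0\neq s\in S$ and words $m,m'$, sends the word $m\operatorname{lm}(s)m'$ to $-\operatorname{lc}(s)^{-1}m\,(s-\operatorname{lc}(s)\operatorname{lm}(s))\,m'$ and fixes all other words; $t\in T$ *reduces* to $t'$ if $t'$ is the image of $t$ under a finite composition of reductions, and $t$ is *irreducible* if it is fixed by all reductions. $(S,\prec)$ is a *commutation system* if $S=\{x_jx_i-c_{ij}x_ix_j-d_{ij}\mid i<j\}$ with $c_{ij}\in K^*$, $d_{ij}\in K[\underline x]$, $\operatorname{lm}(d_{ij})\prec x_ix_j\prec x_jx_i$, and every element of $T$ reduces to an element of $K[\underline x]$. A *PBW-reduction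 datum* $(T,S,I,\prec)$ consists of a commutation system $(S,\prec)$ with $\prec$ a well-ordering and a finite set $I\subseteq K[\underline x]$ such that $\operatorname{L}_\prec(I)=\operatorname{l}_\prec(\langle I\cup S\rangle\cap K[\underline x])$, where $\langle I\cup S\rangle$ is the two-sided ideal generated by $I\cup S$; it is a datum of the *PBW-reduction-algebra* $T/\langle I\cup S\rangle$. Let $A=T/R$ be a PBW-reduction-algebra, $E$ a finite set, $\prec^E$ a monomial ordering on the standard monomials of $T^E$, and for each $e\in E$ let $(T,S_e,I_e,\prec_e)$ be a PBW-reduction datum of $A$ (so $\langle I_e\cup S_e\rangle=R$), with $\prec_e$ induced by $\prec^E$; thus $\prec^E$ is a well-ordering. Every $a\in A$ has for each $e$ a unique representative $\tau_e(a)\in T$ that is irreducible with respect to $(R,\prec_e)$; it lies in $K[\underline x]$. For $v=(v_e)_e\in A^E$ the data $\operatorname{lec}(v),\operatorname{lcomp}(v),\operatorname{le}(v),\operatorname{lc}(v)$ are those of $(\tau_e(v_e))_e\in K[\underline x]^E$, and for $a\in A$, $\operatorname{le}_e(a)$ is the leading exponent of $\tau_e(a)$ with respect to $\prec_e$. Let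 $G\subseteq A^E$ be finite. In the following, $\operatorname{le}_{\operatorname{lcomp}(g)}(h_g)+\operatorname{lec}(g)$ means $\bot$ if $g=0$. * $G$ is a *(left) Gröbner basis* of an $A$-submodule $M\supseteq G$ of $A^E$ if every $m\in M$ can be written as $m=\sum_{g\in G}h_g g$ with $h_g\in A$ and $\operatorname{le}_{\operatorname{lcomp}(g)}(h_g)+\operatorname{lec}(g)\preceq^E\operatorname{lec}(m)$ for all $g\in G$. * A *(left) normal form* of $0\ne a\in A^E$ with respect to $G$ is an $r\in A^E$ such that $a=\sum_{g\in G}h_gg+r$ for some $h_g\in A$ with $\operatorname{le}_{\operatorname{lcomp}(g)}(h_g)+\operatorname{lec}(g)\preceq^E\operatorname{lec}(a)$ for all $g\in G$, and $\operatorname{lec}(r)\notin\operatorname{L}(G)$ if $r\neq0$. The only normal form of $0$ is $0$. * For nonzero $a,a'\in A^E$ with $\operatorname{lcomp}(a)=\operatorname{lcomp}(a')=e$ let $b=\max(\operatorname{le}(a),\operatorname{le}(a'))$ (componentwise), $c=b-\operatorname{le}(a)$ and $c'=b-\operatorname{le}(a')$. If $\underline x^b$ is irreducible with respect to $(R,\prec_e)$,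 put $$\operatorname{spoly}(a,a')=\tfrac{1}{\operatorname{lc}(\underline x^{c}a)}\underline x^{c}a-\tfrac1{\operatorname{lc}(\underline x^{c'}a')}\underline x^{c'}a'.$$ In all other cases (including $a=0$ or $a'=0$) put $\operatorname{spoly}(a,a')=0$. * For $0\neq a\in A^E$, $e=\operatorname{lcomp}(a)$ and $0\ne p\in I_e$ put $\operatorname{spoly}(a,p)=\underline x^{c}a$ with $c=\max(\operatorname{le}(a),\operatorname{le}(p))-\operatorname{le}(a)$, where $\operatorname{le}(p)$ is taken with respect to $\prec_e$; put $\operatorname{spoly}(a,0)=0$. **Proposition (Buchberger criterion for PBW-reduction-algebras).** In this setting the following are equivalent: 1. $G$ is a left Gröbner basis of the $A$-submodule of $A^E$ generated by $G$. 2. For all $g,g'\in G$ some normal form of $\operatorname{spoly}(g,g')$ with respect to $G$ is $0$, and for all nonzero $g\in G$ and all $p\in I_{\operatorname{lcomp}(g)}$ some normal form of $\operatorname{spoly}(g,p)$ with respect to $G$ is $0$. 3. For all $g,g'\in G$ every normal form of $\operatorname{spoly}(g,g')$ with respect to $G$ is $0$, and for all nonzero $g\in G$ and all $p\in I_{\operatorname{lcomp}(g)}$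 every normal form of $\operatorname{spoly}(g,p)$ with respect to $G$ is $0$. -/

import Mathlib

namespace PBW

noncomputable section

/-! ## The free algebra, standard monomials and monomial orderings -/

/-- Monomials `x_{i₁} ⋯ x_{i_k}` of the free associative algebra on `x_0, …, x_{n-1}`. -/
abbrev Word (n : ℕ) := FreeMonoid (Fin n)

/-- The free associative algebra `T = K⟨x_0, …, x_{n-1}⟩`, with its `K`-basis of words. -/
abbrev FreeAlg (K : Type*) [Field K] (n : ℕ) := MonoidAlgebra K (Word n)

/-- The standard monomials `x^α (e)` of `T^E`, i.e. the elements of `ℕ^n × E`. -/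
@[ext]
structure SMon (n : ℕ) (E : Type*) where
  exp : Fin n → ℕ
  comp : E

/-- `β + (α, e) = (β + α, e)`. -/
def SMon.shift {n : ℕ} {E : Type*} (β : Fin n → ℕ) (μ : SMon n E) : SMon n E :=
  ⟨β + μ.exp, μ.comp⟩

/-- The exponent vector `∑ e_{i_j}` of the word `x_{i₁} ⋯ x_{i_k}`. -/
def wordExp {n : ℕ} (w : Word n) : Fin n → ℕ := fun i => (FreeMonoid.toList w).count i

/-- The word `x_0^{α_0} ⋯ x_{n-1}^{α_{n-1}}`. -/
def stdWord {n : ℕ} (α : Fin n → ℕ) : Word n :=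
  (List.ofFn fun i => FreeMonoid.of i ^ α i).prod

/-- The element `x^α` of the free algebra. -/
def stdMon (K : Type*) [Field K] {n : ℕ} (α : Fin n → ℕ) : FreeAlg K n :=
  MonoidAlgebra.single (stdWord α) 1

/-- The polynomial ring `K[x]`, viewed as the subspace of `T` spanned by the standard monomials. -/
def polySub (K : Type*) [Field K] (n : ℕ) : Submodule K (FreeAlg K n) :=
  Submodule.span K (Set.range fun α : Fin n → ℕ => stdMon K α)

/-- A monomial ordering on the standard monomials of `T^E`. -/
structure MonomialOrdering (n : ℕ) (E : Type*) where
  order : LinearOrder (SMon n E)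
  shift_lt : ∀ (γ : Fin n → ℕ) (μ ν : SMon n E),
    order.lt μ ν → order.lt (μ.shift γ) (ν.shift γ)

/-- A monomial ordering is a well-ordering if `(e) ≼ x^α (e)` for all `α` and `e`. -/
def MonomialOrdering.IsWell {n : ℕ} {E : Type*} (O : MonomialOrdering n E) : Prop :=
  ∀ (α : Fin n → ℕ) (e : E), O.order.le ⟨0, e⟩ ⟨α, e⟩

/-- The ordering `≺_e`: `x^α ≺_e x^β` iff `x^α (e) ≺ x^β (e)`.
Orderings on the standard monomials of `T` itself are orderings for a one-element index type. -/
def MonomialOrdering.component {n : ℕ} {E : Type*} (O : MonomialOrdering n E) (e : E) :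
    MonomialOrdering n Unit where
  order := @LinearOrder.lift' _ _ O.order (fun μ : SMon n Unit => (⟨μ.exp, e⟩ : SMon n E))
    (fun μ ν h => by
      have h1 := congrArg SMon.exp h
      exact SMon.ext h1 rfl)
  shift_lt := fun γ μ ν h => O.shift_lt γ ⟨μ.exp, e⟩ ⟨ν.exp, e⟩ h

/-- The refinement of an ordering of the standard monomials of `T` to an ordering of all words:
compare exponent vectors first, then lengths, then lexicographically. -/
@[reducible] def specialOrder {n : ℕ} (O : MonomialOrdering n Unit) : LinearOrder (Word n) :=
  letI := O.order
  LinearOrder.lift'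
    (fun w : Word n => toLex ((⟨wordExp w, ()⟩ : SMon n Unit),
      toLex ((FreeMonoid.toList w).length, FreeMonoid.toList w)))
    (fun w w' h => by
      have h1 := congrArg (fun z => (ofLex (ofLex z).2).2) h
      exact FreeMonoid.toList.injective h1)

/-! ## Reductions in the free algebra -/

section Reduction

variable {K : Type*} [Field K] {n : ℕ}

/-- The leading monomial of an element of `T`, with value `⊥` at `0`. -/
def lmW (O : MonomialOrdering n Unit) (t : FreeAlg K n) : WithBot (Word n) :=
  letI := specialOrder O
  t.coeff.support.max

/-- The leading word of a nonzero element of `T` (with the irrelevant value `1` at `0`). -/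
def leadWord (O : MonomialOrdering n Unit) (t : FreeAlg K n) : Word n := (lmW O t).unbotD 1

/-- The leading coefficient of an element of `T`. -/
def lcW (O : MonomialOrdering n Unit) (t : FreeAlg K n) : K := t.coeff (leadWord O t)

/-- The tail of an element of `T`. -/
def tailW (O : MonomialOrdering n Unit) (t : FreeAlg K n) : FreeAlg K n :=
  t - MonoidAlgebra.single (leadWord O t) (lcW O t)

open Classical in
/-- The reduction map `ρ_{m,s,m'}` (used for `s ≠ 0` only): it sends the word `m lm(s) m'` to
`m (-(1 / lc(s)) tail(s)) m'` and fixes all other words. -/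
def reduction (O : MonomialOrdering n Unit) (m : Word n) (s : FreeAlg K n) (m' : Word n) :
    FreeAlg K n →ₗ[K] FreeAlg K n :=
  (Finsupp.linearCombination K (fun w : Word n =>
    if w = m * leadWord O s * m' then
      MonoidAlgebra.single m 1 * (-((lcW O s)⁻¹ • tailW O s)) * MonoidAlgebra.single m' 1
    else MonoidAlgebra.single w 1)) ∘ₗ
  (MonoidAlgebra.coeffLinearEquiv K).toLinearMap

/-- The reduction maps with respect to `(S, ≺)`. -/
def reductions (O : MonomialOrdering n Unit) (S : Set (FreeAlg K n)) :
    Set (Module.End K (FreeAlg K n)) :=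
  {ρ | ∃ m m' : Word n, ∃ s ∈ S, s ≠ 0 ∧ ρ = reduction O m s m'}

/-- The reduction sequences with respect to `(S, ≺)`: finite compositions of reduction maps. -/
def reductionSeqs (O : MonomialOrdering n Unit) (S : Set (FreeAlg K n)) :
    Submonoid (Module.End K (FreeAlg K n)) :=
  Submonoid.closure (reductions O S)

/-- The space `T^irr` of elements irreducible with respect to `(S, ≺)`. -/
def irr (O : MonomialOrdering n Unit) (S : Set (FreeAlg K n)) : Submodule K (FreeAlg K n) where
  carrier := {t | ∀ ρ ∈ reductionSeqs O S, ρ t = t}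
  add_mem' := fun {a b} ha hb ρ hρ => by rw [map_add, ha ρ hρ, hb ρ hρ]
  zero_mem' := fun ρ _ => map_zero ρ
  smul_mem' := fun c a ha ρ hρ => by rw [map_smul, ha ρ hρ]

/-- The variable `x_i`. -/
def X (K : Type*) [Field K] {n : ℕ} (i : Fin n) : FreeAlg K n :=
  MonoidAlgebra.single (FreeMonoid.of i) 1

/-- `(S, ≺)` is a commutation system: `S` consists of elements
`x_j x_i - c_ij x_i x_j - d_ij` for `i < j`, with `c_ij ≠ 0`, `d_ij ∈ K[x]` and
`lm(d_ij) ≺ x_i x_j ≺ x_j x_i`, and every element of `T` reduces to an element of `K[x]`. -/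
def IsCommutationSystem (S : Set (FreeAlg K n)) (O : MonomialOrdering n Unit) : Prop :=
  letI := specialOrder O
  (∃ (c : Fin n → Fin n → K) (d : Fin n → Fin n → FreeAlg K n),
    (∀ i j, i < j →
      c i j ≠ 0 ∧ d i j ∈ polySub K n ∧
      lmW O (d i j) < ((FreeMonoid.of i * FreeMonoid.of j : Word n) : WithBot (Word n)) ∧
      (FreeMonoid.of i * FreeMonoid.of j : Word n) < FreeMonoid.of j * FreeMonoid.of i) ∧
    S = {s | ∃ i j, i < j ∧ s = X K j * X K i - c i j • (X K i * X K j) - d i j}) ∧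
  ∀ t : FreeAlg K n, ∃ ρ ∈ reductionSeqs O S, ρ t ∈ polySub K n

end Reduction

/-! ## Leading exponents of tuples of polynomials -/

section Leading

variable {K : Type*} [Field K] {n : ℕ} {E : Type*} [Fintype E]

open Classical in
/-- The extended leading exponent of a tuple `t ∈ T^E`, with value `⊥` at `0`. -/
def lecPoly (O : MonomialOrdering n E) (t : E → FreeAlg K n) : WithBot (SMon n E) :=
  letI := O.order
  (Finset.univ.biUnion fun e =>
    (t e).coeff.support.image fun w => (⟨wordExp w, e⟩ : SMon n E)).max

/-- The leading exponent of an element of `T`, with value `⊥` at `0`. -/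
def lePoly (O : MonomialOrdering n Unit) (t : FreeAlg K n) : WithBot (Fin n → ℕ) :=
  (lecPoly O fun _ => t).map SMon.exp

/-- The set `l_≺(G)` of leading exponents of the nonzero elements of `G ⊆ T`. -/
def leadExps (O : MonomialOrdering n Unit) (G : Set (FreeAlg K n)) : Set (Fin n → ℕ) :=
  {α | ∃ g ∈ G, lePoly O g = (α : WithBot (Fin n → ℕ))}

/-- The set `L_≺(G) = ℕ^n + l_≺(G)`. -/
def leadIdeal (O : MonomialOrdering n Unit) (G : Set (FreeAlg K n)) : Set (Fin n → ℕ) :=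
  {γ | ∃ α ∈ leadExps O G, ∃ β : Fin n → ℕ, γ = β + α}

end Leading

/-! ## PBW-reduction-algebras and their free modules -/

section Algebra

/-- `(T, S, I, ≺)` is a PBW-reduction datum: `(S, ≺)` is a commutation system with a
well-ordering `≺`, and `I ⊆ K[x]` is finite with `L_≺(I) = l_≺(⟨I ∪ S⟩ ∩ K[x])`. -/
structure IsPBWReductionDatum {K : Type*} [Field K] {n : ℕ} (S : Set (FreeAlg K n))
    (I : Finset (FreeAlg K n)) (O : MonomialOrdering n Unit) : Prop where
  comm : IsCommutationSystem S O
  well : O.IsWell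
  poly : ∀ p ∈ I, p ∈ polySub K n
  lead : leadIdeal O (I : Set (FreeAlg K n)) =
    leadExps O {t | t ∈ TwoSidedIdeal.span ((I : Set (FreeAlg K n)) ∪ S) ∧ t ∈ polySub K n}

/-- `(S, I, ≺)` is a PBW-reduction datum of the algebra `T / R`. -/
def IsDatumOf {K : Type*} [Field K] {n : ℕ} (R : TwoSidedIdeal (FreeAlg K n))
    (S : Set (FreeAlg K n)) (I : Finset (FreeAlg K n)) (O : MonomialOrdering n Unit) : Prop :=
  IsPBWReductionDatum S I O ∧ R = TwoSidedIdeal.span ((I : Set (FreeAlg K n)) ∪ S)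

/-- A PBW-reduction-algebra `A = T / R`, a finite index set `E`, an ordering `≺^E` and PBW-reduction
data with `(A^E, ≺^E) = (T, S_e, I_e, ≺_e)_{e ∈ E}`, where `≺_e` is the ordering on the `e`-th
component induced by `≺^E`. -/
structure FreeModuleDatum (K : Type*) [Field K] (n : ℕ) (E : Type*) where
  R : TwoSidedIdeal (FreeAlg K n)
  isPBWReductionAlgebra : ∃ S I O, IsDatumOf R S I O
  ord : MonomialOrdering n E
  S : E → Set (FreeAlg K n)
  I : E → Finset (FreeAlg K n)
  isDatum : ∀ e, IsDatumOf R (S e) (I e) (ord.component e)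

namespace FreeModuleDatum

variable {K : Type*} [Field K] {n : ℕ} {E : Type*} (D : FreeModuleDatum K n E)

/-- The PBW-reduction-algebra `A = T / R`. -/
abbrev A : Type _ := D.R.ringCon.Quotient

/-- The quotient map `T → A`. -/
def toA (t : FreeAlg K n) : D.A := D.R.ringCon.mk' t

/-- The space of elements of `T` irreducible with respect to `(⟨I_e ∪ S_e⟩, ≺_e)`. -/
def irrAt (e : E) : Submodule K (FreeAlg K n) :=
  irr (D.ord.component e) {t | t ∈ D.R}

/-- The map `τ` in the component `e`: the inverse of the bijection `T^irr → T → A`. -/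
def tau (e : E) (a : D.A) : FreeAlg K n :=
  (Function.invFun (fun t : D.irrAt e => D.toA (t : FreeAlg K n)) a : D.irrAt e)

/-- The leading exponent of `a ∈ A` with respect to `≺_e`, with value `⊥` at `0`. -/
def le (e : E) (a : D.A) : WithBot (Fin n → ℕ) := lePoly (D.ord.component e) (D.tau e a)

variable [Fintype E]

/-- The extended leading exponent of `v ∈ A^E`, with value `⊥` at `0`. -/
def lec (v : E → D.A) : WithBot (SMon n E) := lecPoly D.ord fun e => D.tau e (v e)

/-- The leading coefficient of `v ∈ A^E`, with value `0` at `0`. -/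
def lc (v : E → D.A) : K :=
  (D.lec v).recBotCoe 0 fun μ => (D.tau μ.comp (v μ.comp)).coeff (stdWord μ.exp)

/-- `L(G)`: the elements `β + lec(g)` of `ℕ^n × E` with `β ∈ ℕ^n` and `0 ≠ g ∈ G`. -/
def L (G : Set (E → D.A)) : Set (SMon n E) :=
  {μ | ∃ g ∈ G, ∃ ν : SMon n E, D.lec g = (ν : WithBot (SMon n E)) ∧
    ∃ β : Fin n → ℕ, μ = ν.shift β}

/-- `le(a) + lec(g)`, where `le(a)` is taken with respect to `≺_e` for `e = lcomp(g)`; the value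
is `⊥` if `a = 0` or `g = 0`. -/
def leAddLec (a : D.A) (g : E → D.A) : WithBot (SMon n E) :=
  (D.lec g).recBotCoe ⊥ fun ν => (D.le ν.comp a).map fun α => ν.shift α

/-- `≼` on extended leading exponents, with `⊥ = lec(0)` as smallest element. -/
def LecLE (μ ν : WithBot (SMon n E)) : Prop :=
  letI := D.ord.order
  μ ≤ ν

/-- `G` is a (left) Gröbner basis of the submodule `M ⊆ A^E`: `G ⊆ M`, and every element of `M`
has a standard representation. -/
def IsGroebnerBasis (G : Finset (E → D.A)) (M : Submodule D.A (E → D.A)) : Prop :=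
  (∀ g ∈ G, g ∈ M) ∧
  ∀ m ∈ M, ∃ h : (E → D.A) → D.A,
    m = ∑ g ∈ G, h g • g ∧ ∀ g ∈ G, D.LecLE (D.leAddLec (h g) g) (D.lec m)

/-- `r` is a (left) normal form of `a` with respect to `G`; the only normal form of `0` is `0`. -/
def IsNormalForm (G : Finset (E → D.A)) (a r : E → D.A) : Prop :=
  (a = 0 ∧ r = 0) ∨
  (a ≠ 0 ∧
    (∃ h : (E → D.A) → D.A,
      a = ∑ g ∈ G, h g • g + r ∧ ∀ g ∈ G, D.LecLE (D.leAddLec (h g) g) (D.lec a)) ∧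
    (r ≠ 0 → ∀ μ : SMon n E, D.lec r = (μ : WithBot (SMon n E)) →
      μ ∉ D.L (G : Set (E → D.A))))

/-- The element `c x^γ a` of `A^E`. -/
def monSMul (c : K) (γ : Fin n → ℕ) (a : E → D.A) : E → D.A :=
  D.toA (c • stdMon K γ) • a

open Classical in
/-- The `s`-polynomial of `a, a' ∈ A^E`. It is `0` if the leading components differ or if the
least common multiple of the leading monomials is not irreducible; it is set to `0` if `a = 0`
or `a' = 0`. -/
def spoly (a a' : E → D.A) : E → D.A :=
  (D.lec a).recBotCoe 0 fun μ => (D.lec a').recBotCoe 0 fun ν =>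
    let b : Fin n → ℕ := μ.exp ⊔ ν.exp
    if μ.comp = ν.comp ∧ stdMon K b ∈ D.irrAt μ.comp then
      D.monSMul (D.lc (D.monSMul 1 (b - μ.exp) a))⁻¹ (b - μ.exp) a -
        D.monSMul (D.lc (D.monSMul 1 (b - ν.exp) a'))⁻¹ (b - ν.exp) a'
    else 0

open Classical in
/-- The `s`-polynomial of `a ∈ A^E` and `p ∈ I_e`. It is `x^c a` with
`c = max(le(a), le(p)) - le(a)` if `e = lcomp(a)`, and `0` otherwise; it is set to `0` if
`a = 0` or `p = 0`. -/
def spolyRel (a : E → D.A) (e : E) (p : FreeAlg K n) : E → D.A :=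
  (D.lec a).recBotCoe 0 fun μ => (lePoly (D.ord.component e) p).recBotCoe 0 fun π =>
    if μ.comp = e then D.monSMul 1 (μ.exp ⊔ π - μ.exp) a else 0

/-- `e` is the leading component of `g` (which is then nonzero). -/
def IsLcomp (g : E → D.A) (e : E) : Prop :=
  ∃ α : Fin n → ℕ, D.lec g = ((⟨α, e⟩ : SMon n E) : WithBot (SMon n E))

end FreeModuleDatum

end Algebra

end

end PBW

namespace PBW

noncomputable section

/-! ## Words and exponents -/

section Words

variable {n : ℕ}

/-! All estimates take place in a filtration of `A` by exponent vectors. The commutation relations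
make two words with the same exponent vector agree in `A` up to a nonzero scalar and words of
smaller exponent (`exists_quotWord_sub_smul_mem`). Reduction modulo `R` never raises exponents, so
the image in `A` of the words with exponents in an initial segment is also the set of classes whose
irreducible representative is supported there (`tau_mem_expSupported_iff`). Products can thus be
estimated without computing representatives.

Let `repSpan G P` be the `K`-span of the multiples `w g`, with `w` a word and `g ∈ G`, such that
`wordExp w + lec(g)` satisfies `P`. A nonzero `v` has a standard representation iff it lies in
`repSpan` with bound `≼ lec(v)`, and every element of the submodule generated by `G` lies in
`repSpan` for some bound `μ`. If `lec(v) ≺ μ`, the bound can be lowered (`mem_repSpan_lt`), in one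
of two ways. When the monomial `μ` is reducible modulo `R`, each top multiple `w g` is, up to lower
multiples, a scalar times a word times some `spoly(g, p)`, which has a lower representation
(`quotWord_smul_mem_repSpan_of_red`). When `μ` is irreducible, the elements `spoly(g, g')` make all
top multiples proportional modulo lower ones (`exists_smul_sub_smul_mem_repSpan`). Then `v` is
congruent to `k w₀ g₀`, whose leading term sits exactly at `μ`, so `k = 0`. As `≺^E` is a
well-ordering, the descent ends in a standard representation, so condition 2 gives condition 1.

Conversely, a normal form of an element of the submodule is again in the submodule. Over a Gröbner
basis a nonzero such element has its `lec` in `L(G)` (`lec_mem_L`), which a normal form forbids;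
this gives condition 3. Division with remainder supplies at least one normal form
(`exists_isNormalForm`), so condition 3 gives condition 2. -/

lemma wordExp_mul (w w' : Word n) : wordExp (w * w') = wordExp w + wordExp w' := by
  funext i
  simp [wordExp, FreeMonoid.toList_mul]

lemma wordExp_one : wordExp (1 : Word n) = 0 := by
  funext i
  simp [wordExp]

lemma wordExp_of (i : Fin n) : wordExp (FreeMonoid.of i) = Pi.single i 1 := by
  funext j
  by_cases h : j = i
  · simp [wordExp, h]
  · simp [wordExp, h, Ne.symm h]

lemma length_eq_sum_wordExp (w : Word n) : (FreeMonoid.toList w).length = ∑ i, wordExp w i := by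
  simpa [wordExp] using (Multiset.sum_count_eq_card (s := Finset.univ)
    (m := ((FreeMonoid.toList w : List (Fin n)) : Multiset (Fin n))) (by simp)).symm

lemma wordExp_pow (w : Word n) (k : ℕ) : wordExp (w ^ k) = k • wordExp w := by
  induction k with
  | zero => simp [wordExp_one]
  | succ k ih => rw [pow_succ, wordExp_mul, ih, succ_nsmul]

lemma wordExp_stdWord (α : Fin n → ℕ) : wordExp (stdWord α) = α := by
  have key : ∀ l : List (Word n), wordExp l.prod = (l.map wordExp).sum := by
    intro l
    induction l with
    | nil => simp [wordExp_one]
    | cons a l ih => simp [wordExp_mul, ih]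
  rw [stdWord, key, List.map_ofFn, List.sum_ofFn]
  funext j
  simp [wordExp_pow, wordExp_of, Finset.sum_apply, Pi.single_apply]

lemma toList_list_prod (l : List (Word n)) :
    FreeMonoid.toList l.prod = (l.map FreeMonoid.toList).flatten := by
  induction l with
  | nil => simp
  | cons a l ih => simp [FreeMonoid.toList_mul, ih]

lemma toList_of_pow (i : Fin n) (k : ℕ) :
    FreeMonoid.toList (FreeMonoid.of i ^ k) = List.replicate k i := by
  induction k with
  | zero => simp
  | succ k ih => rw [pow_succ', FreeMonoid.toList_mul, ih]; simp [List.replicate_succ]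

lemma stdWord_sorted (α : Fin n → ℕ) : (FreeMonoid.toList (stdWord α)).Pairwise (· ≤ ·) := by
  rw [stdWord, toList_list_prod, List.pairwise_flatten, List.map_ofFn]
  constructor
  · intro l hl
    obtain ⟨i, rfl⟩ := List.mem_ofFn.1 hl
    simp [toList_of_pow, List.pairwise_replicate]
  · rw [List.pairwise_ofFn]
    intro i j hij x hx y hy
    simp only [Function.comp_apply, toList_of_pow] at hx hy
    rw [List.eq_of_mem_replicate hx, List.eq_of_mem_replicate hy]
    exact hij.le

lemma eq_of_sorted {w w' : Word n} (hw : (FreeMonoid.toList w).Pairwise (· ≤ ·))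
    (hw' : (FreeMonoid.toList w').Pairwise (· ≤ ·)) (h : wordExp w = wordExp w') : w = w' := by
  apply FreeMonoid.toList.injective
  refine List.Perm.eq_of_pairwise (fun a b _ _ h1 h2 => le_antisymm h1 h2) hw hw' ?_
  rw [List.perm_iff_count]
  exact fun i => congrFun h i

lemma eq_stdWord_of_sorted {w : Word n} (hw : (FreeMonoid.toList w).Pairwise (· ≤ ·)) :
    w = stdWord (wordExp w) :=
  eq_of_sorted hw (stdWord_sorted _) (wordExp_stdWord _).symm

lemma of_mul_of_eq_stdWord {i j : Fin n} (h : i ≤ j) :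
    (FreeMonoid.of i * FreeMonoid.of j : Word n) =
      stdWord (wordExp (FreeMonoid.of i * FreeMonoid.of j)) := by
  apply eq_stdWord_of_sorted
  simp [FreeMonoid.toList_mul, h]

lemma list_exists_descent {α : Type*} [LinearOrder α] {l : List α} (h : ¬ l.Pairwise (· ≤ ·)) :
    ∃ (a b : List α) (i j : α), i < j ∧ l = a ++ j :: i :: b := by
  rw [← List.isChain_iff_pairwise] at h
  induction l with
  | nil => simp at h
  | cons x l ih =>
    cases l with
    | nil => simp at h
    | cons y l =>
      by_cases hxy : x ≤ y
      · obtain ⟨a, b, i, j, hij, hl⟩ := ih (by simpa [List.isChain_cons_cons, hxy] using h)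
        exact ⟨x :: a, b, i, j, hij, by rw [hl]; rfl⟩
      · exact ⟨[], l, y, x, not_le.1 hxy, rfl⟩

/-- An unsorted word has an adjacent inversion, which is exactly where a commutation relation
applies. -/
lemma exists_descent {w : Word n} (h : w ≠ stdWord (wordExp w)) :
    ∃ (m m' : Word n) (i j : Fin n), i < j ∧
      w = m * (FreeMonoid.of j * FreeMonoid.of i) * m' := by
  obtain ⟨a, b, i, j, hij, hl⟩ :=
    list_exists_descent (fun hs : (FreeMonoid.toList w).Pairwise (· ≤ ·) =>
      h (eq_stdWord_of_sorted hs))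
  refine ⟨FreeMonoid.ofList a, FreeMonoid.ofList b, i, j, hij, ?_⟩
  apply FreeMonoid.toList.injective
  simp [FreeMonoid.toList_mul, hl]

lemma finite_wordExp_eq (α : Fin n → ℕ) : {w : Word n | wordExp w = α}.Finite := by
  refine ((List.finite_length_eq (Fin n) (∑ i, α i)).preimage
    (f := FreeMonoid.toList) FreeMonoid.toList.injective.injOn).subset ?_
  rintro w rfl
  exact length_eq_sum_wordExp w

/-- Equal lengths are needed: a proper prefix is smaller, but appending can reverse that comparison.
-/
lemma list_append_lt_append {α : Type*} [LinearOrder α] {l l' : List α}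
    (hl : l.length = l'.length) (h : l < l') (b : List α) : l ++ b < l' ++ b := by
  change List.Lex (· < ·) l l' at h
  change List.Lex (· < ·) (l ++ b) (l' ++ b)
  induction h with
  | nil => simp at hl
  | rel h => exact .rel h
  | cons _ ih => exact .cons (ih (by simpa using hl))

end Words

/-! ## Orderings -/

section Orders

variable {n : ℕ} {E : Type*}

lemma SMon.shift_shift (β γ : Fin n → ℕ) (μ : SMon n E) :
    (μ.shift γ).shift β = μ.shift (β + γ) := by
  simp [SMon.shift, add_assoc]

lemma MonomialOrdering.shift_le (O : MonomialOrdering n E) (γ : Fin n → ℕ) {μ ν : SMon n E}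
    (h : O.order.le μ ν) : O.order.le (μ.shift γ) (ν.shift γ) := by
  let _ := O.order
  rcases h.eq_or_lt with rfl | h
  · exact le_refl _
  · exact (O.shift_lt γ _ _ h).le

lemma MonomialOrdering.IsWell.le_shift {O : MonomialOrdering n E} (hO : O.IsWell)
    (γ : Fin n → ℕ) (μ : SMon n E) : O.order.le μ (μ.shift γ) := by
  have := O.shift_le μ.exp (hO γ μ.comp)
  simpa [SMon.shift, add_comm] using this

/-- Dickson's lemma: in an infinite descending chain some earlier exponent divides a later one in
the same component, which makes the earlier element the smaller one. -/
lemma MonomialOrdering.IsWell.wellFounded [Finite E] {O : MonomialOrdering n E} (hO : O.IsWell) :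
    WellFounded O.order.lt := by
  let _ := O.order
  rw [wellFounded_iff_isEmpty_descending_chain]
  refine ⟨fun ⟨f, hf⟩ => ?_⟩
  have hanti : StrictAnti f := strictAnti_nat_of_succ_lt hf
  have hwqo : WellQuasiOrdered (fun a b : (Fin n → ℕ) × E => a.1 ≤ b.1 ∧ a.2 = b.2) :=
    WellQuasiOrdered.prod wellQuasiOrdered_le (Finite.wellQuasiOrdered (· = ·))
  obtain ⟨i, j, hij, h1, h2⟩ := hwqo (fun k => ((f k).exp, (f k).comp))
  have hle := hO.le_shift ((f j).exp - (f i).exp) (f i)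
  have : (f i).shift ((f j).exp - (f i).exp) = f j :=
    SMon.ext (tsub_add_cancel_of_le h1) h2
  rw [this] at hle
  exact absurd (hanti hij) (not_lt.2 hle)

/-- The exponent vector determines the length, so the length comparison never decides. -/
lemma specialOrder_lt_iff (O : MonomialOrdering n Unit) (w w' : Word n) :
    (specialOrder O).lt w w' ↔ O.order.lt ⟨wordExp w, ()⟩ ⟨wordExp w', ()⟩ ∨
      (wordExp w = wordExp w' ∧ FreeMonoid.toList w < FreeMonoid.toList w') := by
  let _ := O.order
  have : (specialOrder O).lt w w' ↔ toLex ((⟨wordExp w, ()⟩ : SMon n Unit),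
      toLex ((FreeMonoid.toList w).length, FreeMonoid.toList w)) <
      toLex ((⟨wordExp w', ()⟩ : SMon n Unit),
      toLex ((FreeMonoid.toList w').length, FreeMonoid.toList w')) := Iff.rfl
  rw [this, Prod.Lex.lt_iff]
  refine or_congr Iff.rfl ?_
  rw [Prod.Lex.lt_iff]
  constructor
  · rintro ⟨h1, h2⟩
    have h1' : wordExp w = wordExp w' := congrArg SMon.exp h1
    refine ⟨h1', ?_⟩
    rcases h2 with h2 | h2
    · simp [length_eq_sum_wordExp, h1'] at h2
    · exact h2.2
  · rintro ⟨h1, h2⟩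
    refine ⟨SMon.ext h1 rfl, Or.inr ⟨?_, h2⟩⟩
    simp [length_eq_sum_wordExp, h1]

lemma wordExp_le_of_specialOrder_le (O : MonomialOrdering n Unit) {w w' : Word n}
    (h : (specialOrder O).le w w') : O.order.le ⟨wordExp w, ()⟩ ⟨wordExp w', ()⟩ := by
  let _ := O.order
  rcases (@le_iff_eq_or_lt _ (specialOrder O).toPartialOrder w w').1 h with rfl | h
  · exact le_refl _
  · rcases (specialOrder_lt_iff O w w').1 h with h | h
    · exact le_of_lt h
    · rw [h.1]

lemma specialOrder_mul_lt (O : MonomialOrdering n Unit) {w w' : Word n}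
    (h : (specialOrder O).lt w w') (m m' : Word n) :
    (specialOrder O).lt (m * w * m') (m * w' * m') := by
  rw [specialOrder_lt_iff] at h ⊢
  simp only [wordExp_mul, FreeMonoid.toList_mul]
  rcases h with h | ⟨h1, h2⟩
  · left
    have := O.shift_lt (wordExp m + wordExp m') _ _ h
    simpa only [SMon.shift, add_right_comm] using this
  · right
    refine ⟨by rw [h1], ?_⟩
    simp only [List.append_assoc]
    refine List.append_left_lt (list_append_lt_append ?_ h2 _)
    rw [length_eq_sum_wordExp, length_eq_sum_wordExp, h1]

/-- The lexicographic order on lists is not well-founded in general, but it only breaks ties among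
the finitely many words with a given exponent vector. -/
lemma MonomialOrdering.IsWell.wellFounded_specialOrder {O : MonomialOrdering n Unit}
    (hO : O.IsWell) : WellFounded (specialOrder O).lt := by
  let _ := O.order
  have h1 : WellFounded (Function.onFun O.order.lt fun w : Word n => ⟨wordExp w, ()⟩) :=
    hO.wellFounded.onFun
  have h2 := WellFounded.prod_lex_of_wellFoundedOn_fiber
    (rβ := fun a b : List (Fin n) => a < b) (g := fun w : Word n => FreeMonoid.toList w) h1
    (fun a => by
      have hfin : ((fun w : Word n => (⟨wordExp w, ()⟩ : SMon n Unit)) ⁻¹' {a}).Finite := by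
        refine (finite_wordExp_eq a.exp).subset ?_
        rintro w rfl
        rfl
      have : IsStrictOrder (Word n)
          (Function.onFun (fun a b : List (Fin n) => a < b) FreeMonoid.toList) :=
        { irrefl := fun a => lt_irrefl (FreeMonoid.toList a)
          trans := fun a b c => lt_trans (a := FreeMonoid.toList a) }
      exact hfin.wellFoundedOn)
  refine Subrelation.wf ?_ h2
  intro w w' h
  rcases (specialOrder_lt_iff O w w').1 h with h | ⟨h, h'⟩
  · exact Prod.Lex.left _ _ h
  · simp only [Function.onFun, h]
    exact Prod.Lex.right _ h'

end Orders

/-! ## Leading words and leading exponents -/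

section Leading

variable {K : Type*} [Field K] {n : ℕ} {E : Type*}

lemma leadWord_spec (O : MonomialOrdering n Unit) {t : FreeAlg K n} (ht : t ≠ 0) :
    leadWord O t ∈ t.coeff.support ∧
      ∀ w ∈ t.coeff.support, (specialOrder O).le w (leadWord O t) := by
  let _ := specialOrder O
  have hne : t.coeff.support.Nonempty := by
    rw [Finsupp.support_nonempty_iff]
    simpa using ht
  obtain ⟨w, hw⟩ := Finset.max_of_nonempty hne
  have hlead : leadWord O t = w := by
    have : lmW O t = (w : WithBot (Word n)) := hw
    rw [leadWord, this]
    rfl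
  rw [hlead]
  exact ⟨Finset.mem_of_max hw, fun v hv => Finset.le_max_of_eq hv hw⟩

lemma leadWord_eq (O : MonomialOrdering n Unit) {t : FreeAlg K n} {w : Word n}
    (hw : w ∈ t.coeff.support) (hmax : ∀ v ∈ t.coeff.support, (specialOrder O).le v w) :
    leadWord O t = w := by
  let _ := specialOrder O
  have ht : t ≠ 0 := by rintro rfl; simp at hw
  obtain ⟨h1, h2⟩ := leadWord_spec O ht
  exact le_antisymm (hmax _ h1) (h2 _ hw)

lemma lcW_ne_zero (O : MonomialOrdering n Unit) {t : FreeAlg K n} (ht : t ≠ 0) :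
    lcW O t ≠ 0 :=
  Finsupp.mem_support_iff.1 (leadWord_spec O ht).1

lemma lecPoly_eq_coe_iff [Fintype E] (O : MonomialOrdering n E) (t : E → FreeAlg K n)
    (μ : SMon n E) : lecPoly O t = (μ : WithBot (SMon n E)) ↔
      (∃ w ∈ (t μ.comp).coeff.support, wordExp w = μ.exp) ∧
        ∀ e, ∀ w ∈ (t e).coeff.support, O.order.le ⟨wordExp w, e⟩ μ := by
  classical
  let _ := O.order
  constructor
  · intro h
    constructor
    · have := Finset.mem_of_max h
      simp only [Finset.mem_biUnion, Finset.mem_univ, true_and, Finset.mem_image] at this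
      obtain ⟨e, w, hw, rfl⟩ := this
      exact ⟨w, hw, rfl⟩
    · intro e w hw
      refine Finset.le_max_of_eq ?_ h
      simp only [Finset.mem_biUnion, Finset.mem_univ, true_and, Finset.mem_image]
      exact ⟨e, w, hw, rfl⟩
  · rintro ⟨⟨w, hw, hwμ⟩, hmax⟩
    refine le_antisymm (Finset.max_le ?_) (Finset.le_max ?_)
    · intro ν hν
      simp only [Finset.mem_biUnion, Finset.mem_univ, true_and, Finset.mem_image] at hν
      obtain ⟨e, w, hw, rfl⟩ := hν
      exact WithBot.coe_le_coe.2 (hmax e w hw)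
    · simp only [Finset.mem_biUnion, Finset.mem_univ, true_and, Finset.mem_image]
      exact ⟨μ.comp, w, hw, SMon.ext hwμ rfl⟩

lemma lecPoly_eq_bot_iff [Fintype E] (O : MonomialOrdering n E) (t : E → FreeAlg K n) :
    lecPoly O t = ⊥ ↔ t = 0 := by
  classical
  let _ := O.order
  rw [lecPoly, Finset.max_eq_bot, Finset.eq_empty_iff_forall_notMem]
  simp only [Finset.mem_biUnion, Finset.mem_univ, true_and, Finset.mem_image, not_exists, not_and]
  constructor
  · intro h
    funext e
    rw [Pi.zero_apply, ← MonoidAlgebra.coeff_eq_zero, ← Finsupp.support_eq_empty,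
      Finset.eq_empty_iff_forall_notMem]
    exact fun w hw => h _ e w hw rfl
  · rintro rfl μ e w hw
    simp at hw

lemma lePoly_eq_coe_iff (O : MonomialOrdering n Unit) (t : FreeAlg K n) (α : Fin n → ℕ) :
    lePoly O t = (α : WithBot (Fin n → ℕ)) ↔
      (∃ w ∈ t.coeff.support, wordExp w = α) ∧
        ∀ w ∈ t.coeff.support, O.order.le ⟨wordExp w, ()⟩ ⟨α, ()⟩ := by
  have h := lecPoly_eq_coe_iff O (fun _ : Unit => t) ⟨α, ()⟩
  rw [lePoly, WithBot.map_eq_some_iff]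
  constructor
  · rintro ⟨μ, hμ, rfl⟩
    exact ⟨(h.1 hμ).1, (h.1 hμ).2 ()⟩
  · rintro ⟨h1, h2⟩
    exact ⟨⟨α, ()⟩, h.2 ⟨h1, fun _ => h2⟩, rfl⟩

lemma lePoly_eq_bot_iff (O : MonomialOrdering n Unit) (t : FreeAlg K n) :
    lePoly O t = ⊥ ↔ t = 0 := by
  rw [lePoly, WithBot.map_eq_bot_iff, lecPoly_eq_bot_iff]
  exact ⟨fun h => congrFun h (), fun h => funext fun _ => h⟩

lemma wordExp_leadWord (O : MonomialOrdering n Unit) {t : FreeAlg K n} (ht : t ≠ 0) :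
    lePoly O t = (wordExp (leadWord O t) : WithBot (Fin n → ℕ)) := by
  obtain ⟨h1, h2⟩ := leadWord_spec O ht
  rw [lePoly_eq_coe_iff]
  exact ⟨⟨_, h1, rfl⟩, fun w hw => wordExp_le_of_specialOrder_le O (h2 w hw)⟩

lemma leadWord_mul_mul (O : MonomialOrdering n Unit) {t : FreeAlg K n} (ht : t ≠ 0)
    (m m' : Word n) :
    (MonoidAlgebra.single m 1 * t * MonoidAlgebra.single m' 1 : FreeAlg K n) ≠ 0 ∧
    leadWord O (MonoidAlgebra.single m 1 * t * MonoidAlgebra.single m' 1) =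
      m * leadWord O t * m' := by
  classical
  let _ := specialOrder O
  obtain ⟨h1, h2⟩ := leadWord_spec O ht
  have hsupp : (MonoidAlgebra.single m 1 * t * MonoidAlgebra.single m' 1 :
      FreeAlg K n).coeff.support = t.coeff.support.image fun w => m * w * m' := by
    rw [MonoidAlgebra.support_coeff_mul_single_eq_image _ (by simp)
        (IsRightRegular.all m'),
      MonoidAlgebra.support_coeff_single_mul_eq_image _ (by simp) (IsLeftRegular.all m),
      Finset.image_image]
    rfl
  have hmem : m * leadWord O t * m' ∈ (MonoidAlgebra.single m 1 * t * MonoidAlgebra.single m' 1 :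
      FreeAlg K n).coeff.support := by
    rw [hsupp]
    exact Finset.mem_image_of_mem _ h1
  refine ⟨fun h => by simp [h] at hmem, leadWord_eq O hmem fun v hv => ?_⟩
  rw [hsupp, Finset.mem_image] at hv
  obtain ⟨w, hw, rfl⟩ := hv
  rcases (h2 w hw).eq_or_lt with h | h
  · rw [h]
  · exact (specialOrder_mul_lt O h m m').le

end Leading

/-! ## Reductions with respect to a two-sided ideal -/

section Reduction

variable {K : Type*} [Field K] {n : ℕ}

lemma polySub_eq_supported :
    polySub K n = MonoidAlgebra.supported K K (Set.range (stdWord (n := n))) := by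
  rw [MonoidAlgebra.supported_eq_span_single, polySub, ← Set.range_comp]
  rfl

lemma stdMon_mem_polySub (α : Fin n → ℕ) : stdMon K α ∈ polySub K n :=
  Submodule.subset_span ⟨α, rfl⟩

lemma eq_stdWord_of_mem_support {t : FreeAlg K n} (ht : t ∈ polySub K n) {w : Word n}
    (hw : w ∈ t.coeff.support) : w = stdWord (wordExp w) := by
  rw [polySub_eq_supported, MonoidAlgebra.mem_supported] at ht
  obtain ⟨α, rfl⟩ := ht hw
  rw [wordExp_stdWord]

/-- Written as a subtraction, a reduction visibly changes `t` only by a multiple of `m s m'`, hence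
by an element of any two-sided ideal containing `s`. -/
lemma reduction_apply (O : MonomialOrdering n Unit) (m : Word n) {s : FreeAlg K n} (hs : s ≠ 0)
    (m' : Word n) (t : FreeAlg K n) :
    reduction O m s m' t = t - (t.coeff (m * leadWord O s * m') * (lcW O s)⁻¹) •
      (MonoidAlgebra.single m 1 * s * MonoidAlgebra.single m' 1) := by
  classical
  have hlc := lcW_ne_zero O hs
  induction t using MonoidAlgebra.induction_linear with
  | zero => simp
  | add f g hf hg =>
    rw [map_add, hf, hg, MonoidAlgebra.coeff_add, Finsupp.add_apply, add_mul, add_smul]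
    abel
  | single w c =>
    have h1 : reduction O m s m' (MonoidAlgebra.single w c) = c •
        (if w = m * leadWord O s * m' then
          MonoidAlgebra.single m 1 * (-((lcW O s)⁻¹ • tailW O s)) * MonoidAlgebra.single m' 1
        else MonoidAlgebra.single w 1) := by
      simp [reduction, MonoidAlgebra.coeffLinearEquiv]
    rw [h1]
    split_ifs with h
    · have h2 : (MonoidAlgebra.single m 1 * MonoidAlgebra.single (leadWord O s) (lcW O s) *
          MonoidAlgebra.single m' 1 : FreeAlg K n) = lcW O s • MonoidAlgebra.single w 1 := by
        rw [h]; simp [MonoidAlgebra.single_mul_single]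
      have h3 : (MonoidAlgebra.single w c : FreeAlg K n) = c • MonoidAlgebra.single w 1 := by simp
      rw [← h, h3, MonoidAlgebra.coeff_smul_apply, tailW]
      simp only [mul_neg, neg_mul, mul_smul_comm, smul_mul_assoc, mul_sub, sub_mul, h2,
        smul_sub, smul_smul, MonoidAlgebra.coeff_single, Finsupp.single_eq_same, smul_eq_mul,
        mul_one, inv_mul_cancel₀ hlc, one_smul, smul_neg]
      abel
    · simp [h]

/-- Linear combinations of words whose exponent vectors satisfy `P`. -/
def expSupported (K : Type*) [Field K] {n : ℕ} (P : (Fin n → ℕ) → Prop) :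
    Submodule K (FreeAlg K n) :=
  MonoidAlgebra.supported K K {w | P (wordExp w)}

lemma mem_expSupported {P : (Fin n → ℕ) → Prop} {t : FreeAlg K n} :
    t ∈ expSupported K P ↔ ∀ w ∈ t.coeff.support, P (wordExp w) := Iff.rfl

lemma single_mem_expSupported {P : (Fin n → ℕ) → Prop} {w : Word n} (h : P (wordExp w)) (c : K) :
    MonoidAlgebra.single w c ∈ expSupported K P := by
  rw [mem_expSupported]
  intro v hv
  have := Finsupp.support_single_subset hv
  rw [Finset.mem_singleton] at this
  rwa [this]

/-- The words that are leading words of nonzero elements of `R`. -/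
def redWords (O : MonomialOrdering n Unit) (R : TwoSidedIdeal (FreeAlg K n)) : Set (Word n) :=
  {w | ∃ s ∈ R, s ≠ 0 ∧ leadWord O s = w}

variable (O : MonomialOrdering n Unit) (R : TwoSidedIdeal (FreeAlg K n))

lemma smul_mem_twoSidedIdeal {R : TwoSidedIdeal (FreeAlg K n)} (c : K) {t : FreeAlg K n}
    (ht : t ∈ R) : c • t ∈ R := by
  rw [Algebra.smul_def]
  exact R.mul_mem_left _ _ ht

/-- A two-sided ideal contains `m s m'` along with `s`, and the order is compatible with
multiplication, so the words that reductions can move are precisely the leading words of `R`. -/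
lemma irr_eq_supported : irr O {t | t ∈ R} = MonoidAlgebra.supported K K (redWords O R)ᶜ := by
  ext t
  rw [MonoidAlgebra.mem_supported]
  constructor
  · rintro ht w hw ⟨s, hsR, hs, rfl⟩
    -- The reduction with `m = m' = 1` already detects that a leading word of `R` is present.
    have h := ht _ (Submonoid.subset_closure ⟨1, 1, s, hsR, hs, rfl⟩)
    rw [reduction_apply O _ hs, sub_eq_self, smul_eq_zero] at h
    simp only [one_mul, mul_one, ← MonoidAlgebra.one_def, mul_eq_zero, inv_eq_zero] at h
    rcases h with (h | h) | h
    · exact Finsupp.mem_support_iff.1 hw h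
    · exact lcW_ne_zero O hs h
    · exact hs h
  · intro ht ρ hρ
    induction hρ using Submonoid.closure_induction with
    | mem ρ hρ =>
      obtain ⟨m, m', s, hsR, hs, rfl⟩ := hρ
      obtain ⟨h1, h2⟩ := leadWord_mul_mul O hs m m'
      have : t.coeff (m * leadWord O s * m') = 0 := by
        by_contra h
        exact ht (Finsupp.mem_support_iff.2 h)
          ⟨_, R.mul_mem_right _ _ (R.mul_mem_left _ _ hsR), h1, h2⟩
      rw [reduction_apply O _ hs, this, zero_mul, zero_smul, sub_zero]
    | one => rfl
    | mul ρ ρ' _ _ h h' => rw [Module.End.mul_apply, h', h]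

lemma eq_zero_of_mem_irr {t : FreeAlg K n} (ht : t ∈ irr O {t | t ∈ R}) (htR : t ∈ R) :
    t = 0 := by
  by_contra h
  rw [irr_eq_supported, MonoidAlgebra.mem_supported] at ht
  exact ht (leadWord_spec O h).1 ⟨t, htR, h, rfl⟩

variable {O}

lemma exists_irr_of_forall_word {s s' : Set (Word n)}
    (h : ∀ w ∈ s, ∃ u ∈ irr O {t | t ∈ R}, MonoidAlgebra.single w 1 - u ∈ R ∧
      u ∈ MonoidAlgebra.supported K K s') {t : FreeAlg K n}
    (ht : t ∈ MonoidAlgebra.supported K K s) :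
    ∃ u ∈ irr O {t | t ∈ R}, t - u ∈ R ∧ u ∈ MonoidAlgebra.supported K K s' := by
  rw [MonoidAlgebra.supported_eq_span_single] at ht
  induction ht using Submodule.span_induction with
  | mem x hx =>
    obtain ⟨w, hw, rfl⟩ := hx
    exact h w hw
  | zero => exact ⟨0, zero_mem _, by simp, zero_mem _⟩
  | add x y _ _ hx hy =>
    obtain ⟨u, hu, huR, hus⟩ := hx
    obtain ⟨u', hu', huR', hus'⟩ := hy
    refine ⟨u + u', add_mem hu hu', ?_, add_mem hus hus'⟩
    rw [add_sub_add_comm]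
    exact R.add_mem huR huR'
  | smul c x _ hx =>
    obtain ⟨u, hu, huR, hus⟩ := hx
    refine ⟨c • u, Submodule.smul_mem _ _ hu, ?_, Submodule.smul_mem _ _ hus⟩
    rw [← smul_sub]
    exact smul_mem_twoSidedIdeal _ huR

/-- Well-founded induction on the word: a leading word of `R` is traded for a multiple of the tail,
all of whose words are smaller. -/
lemma exists_irr_word (hO : O.IsWell) (w : Word n) :
    ∃ u ∈ irr O {t | t ∈ R}, MonoidAlgebra.single w 1 - u ∈ R ∧
      u ∈ MonoidAlgebra.supported K K {v | (specialOrder O).le v w} := by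
  induction w using hO.wellFounded_specialOrder.induction with
  | _ w ih =>
    let _ := specialOrder O
    by_cases hw : w ∈ redWords O R
    · obtain ⟨s, hsR, hs, rfl⟩ := hw
      have hlc := lcW_ne_zero O hs
      have htail : ∀ v ∈ (tailW O s).coeff.support, v < leadWord O s := by
        intro v hv
        have hne : v ≠ leadWord O s := by
          rintro rfl
          rw [Finsupp.mem_support_iff] at hv
          simp [tailW, lcW] at hv
        have hv' : v ∈ s.coeff.support := by
          rw [Finsupp.mem_support_iff] at hv ⊢
          simpa [tailW, hne.symm] using hv
        exact lt_of_le_of_ne ((leadWord_spec O hs).2 v hv') hne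
      have key : ∃ u ∈ irr O {t | t ∈ R}, tailW O s - u ∈ R ∧
          u ∈ MonoidAlgebra.supported K K {v | v < leadWord O s} := by
        refine exists_irr_of_forall_word R (s := {v | v < leadWord O s}) (fun v hv => ?_) htail
        obtain ⟨u, hu, huR, hus⟩ := ih v hv
        exact ⟨u, hu, huR, fun x hx => show x < leadWord O s from lt_of_le_of_lt (hus hx) hv⟩
      obtain ⟨u, hu, huR, hus⟩ := key
      refine ⟨-((lcW O s)⁻¹ • u), neg_mem (Submodule.smul_mem _ _ hu), ?_,
        neg_mem (Submodule.smul_mem _ _ fun x hx => show x ≤ leadWord O s from le_of_lt (hus hx))⟩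
      have : (MonoidAlgebra.single (leadWord O s) 1 : FreeAlg K n) - -((lcW O s)⁻¹ • u) =
          (lcW O s)⁻¹ • (s - (tailW O s - u)) := by
        have : (MonoidAlgebra.single (leadWord O s) (lcW O s) : FreeAlg K n) =
          lcW O s • MonoidAlgebra.single (leadWord O s) 1 := by simp
        rw [tailW, this, smul_sub, smul_sub, smul_sub, smul_smul, inv_mul_cancel₀ hlc, one_smul]
        abel
      rw [this]
      exact smul_mem_twoSidedIdeal _ (R.sub_mem hsR huR)
    · refine ⟨MonoidAlgebra.single w 1, ?_, by simp, ?_⟩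
      · rw [irr_eq_supported, MonoidAlgebra.mem_supported]
        intro v hv
        have := Finsupp.support_single_subset hv
        rw [Finset.mem_singleton] at this
        rwa [this]
      · rw [MonoidAlgebra.mem_supported]
        intro v hv
        have := Finsupp.support_single_subset hv
        rw [Finset.mem_singleton] at this
        exact this.le

/-- Every element of `T` is congruent modulo `R` to an irreducible one whose words are bounded by
words of the given element. -/
lemma exists_irr (hO : O.IsWell) {s : Set (Word n)}
    (hs : ∀ w ∈ s, ∀ v, (specialOrder O).le v w → v ∈ s) {t : FreeAlg K n}
    (ht : t ∈ MonoidAlgebra.supported K K s) :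
    ∃ u ∈ irr O {t | t ∈ R}, t - u ∈ R ∧ u ∈ MonoidAlgebra.supported K K s := by
  refine exists_irr_of_forall_word R (fun w hw => ?_) ht
  obtain ⟨u, hu, huR, hus⟩ := exists_irr_word R hO w
  exact ⟨u, hu, huR, fun v hv => hs w hw v (hus hv)⟩

end Reduction

/-! ## The quotient by a two-sided ideal containing a commutation system -/

section Quotient

variable {K : Type*} [Field K] {n : ℕ} (R : TwoSidedIdeal (FreeAlg K n))

/-- The quotient map `T → T / R` as a homomorphism of `K`-algebras. -/
def quot : FreeAlg K n →ₐ[K] R.ringCon.Quotient := RingCon.mkₐ K R.ringCon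

lemma quot_surjective : Function.Surjective (quot R) := Quotient.mk_surjective

variable {R} in
lemma quot_eq_quot_iff {s t : FreeAlg K n} : quot R s = quot R t ↔ s - t ∈ R := by
  rw [← TwoSidedIdeal.rel_iff]
  exact RingCon.eq R.ringCon

variable {R} in
lemma quot_eq_zero_iff {t : FreeAlg K n} : quot R t = 0 ↔ t ∈ R := by
  rw [← map_zero (quot R), quot_eq_quot_iff, sub_zero]

/-- The residue class of a word. -/
def quotWord (w : Word n) : R.ringCon.Quotient := quot R (MonoidAlgebra.single w 1)

lemma quotWord_mul (w w' : Word n) : quotWord R (w * w') = quotWord R w * quotWord R w' := by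
  rw [quotWord, quotWord, quotWord, ← map_mul, MonoidAlgebra.single_mul_single, one_mul]

lemma quotWord_one : quotWord R (1 : Word n) = 1 := by
  rw [quotWord, ← MonoidAlgebra.one_def, map_one]

/-- Residue classes of linear combinations of words whose exponent vectors satisfy `P`. -/
def expSpan (P : (Fin n → ℕ) → Prop) : Submodule K R.ringCon.Quotient :=
  (expSupported K P).map (quot R).toLinearMap

lemma expSpan_eq_span (P : (Fin n → ℕ) → Prop) :
    expSpan R P = Submodule.span K (quotWord R '' {w | P (wordExp w)}) := by
  rw [expSpan, expSupported, MonoidAlgebra.supported_eq_span_single, Submodule.map_span,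
    Set.image_image]
  rfl

variable {R}

lemma quotWord_mem_expSpan {P : (Fin n → ℕ) → Prop} {w : Word n} (h : P (wordExp w)) :
    quotWord R w ∈ expSpan R P :=
  Submodule.mem_map_of_mem (single_mem_expSupported h 1)

lemma expSpan_mono {P Q : (Fin n → ℕ) → Prop} (h : ∀ α, P α → Q α) :
    expSpan R P ≤ expSpan R Q :=
  Submodule.map_mono fun _ ht _ hw => h _ (ht hw)

lemma quotWord_mul_mem_expSpan {P Q : (Fin n → ℕ) → Prop} {w : Word n}
    (h : ∀ α, P α → Q (wordExp w + α)) {a : R.ringCon.Quotient} (ha : a ∈ expSpan R P) :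
    quotWord R w * a ∈ expSpan R Q := by
  rw [expSpan_eq_span] at ha
  induction ha using Submodule.span_induction with
  | mem x hx =>
    obtain ⟨v, hv, rfl⟩ := hx
    rw [← quotWord_mul]
    exact quotWord_mem_expSpan (by rw [wordExp_mul]; exact h _ hv)
  | zero => simp
  | add x y _ _ hx hy => rw [mul_add]; exact add_mem hx hy
  | smul c x _ hx => rw [mul_smul_comm]; exact Submodule.smul_mem _ _ hx

lemma mul_quotWord_mem_expSpan {P Q : (Fin n → ℕ) → Prop} {w : Word n}
    (h : ∀ α, P α → Q (α + wordExp w)) {a : R.ringCon.Quotient} (ha : a ∈ expSpan R P) :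
    a * quotWord R w ∈ expSpan R Q := by
  rw [expSpan_eq_span] at ha
  induction ha using Submodule.span_induction with
  | mem x hx =>
    obtain ⟨v, hv, rfl⟩ := hx
    rw [← quotWord_mul]
    exact quotWord_mem_expSpan (by rw [wordExp_mul]; exact h _ hv)
  | zero => simp
  | add x y _ _ hx hy => rw [add_mul]; exact add_mem hx hy
  | smul c x _ hx => rw [smul_mul_assoc]; exact Submodule.smul_mem _ _ hx

variable {O : MonomialOrdering n Unit} {S : Set (FreeAlg K n)}

/-- Some composition of `S`-reductions carries `t` into `K[x]`; since `S ⊆ R`, it fixes an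
irreducible `t`. -/
lemma irr_le_polySub (hS : IsCommutationSystem S O) (hSR : ∀ s ∈ S, s ∈ R) :
    irr O {t | t ∈ R} ≤ polySub K n := by
  intro t ht
  obtain ⟨ρ, hρ, hρt⟩ := hS.2 t
  have hmono : reductionSeqs O S ≤ reductionSeqs O {t | t ∈ R} := by
    refine Submonoid.closure_mono ?_
    rintro _ ⟨m, m', s, hs, hs0, rfl⟩
    exact ⟨m, m', s, hSR s hs, hs0, rfl⟩
  rwa [ht ρ (hmono hρ)] at hρt

/-- A standard word is determined by its exponent vector, so between standard words the tie-breaking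
rules play no role and the inequality is strict on exponents. -/
lemma expSupported_of_lmW_lt {d : FreeAlg K n} (hd : d ∈ polySub K n) {α : Fin n → ℕ}
    (h : letI := specialOrder O; lmW O d < (stdWord α : WithBot (Word n))) :
    d ∈ expSupported K fun β => O.order.lt ⟨β, ()⟩ ⟨α, ()⟩ := by
  intro w hw
  let _ := specialOrder O
  have hlt : w < stdWord α :=
    WithBot.coe_lt_coe.1 (lt_of_le_of_lt (Finset.le_max hw) h)
  rcases (specialOrder_lt_iff O _ _).1 hlt with h1 | ⟨h1, h2⟩
  · rwa [wordExp_stdWord] at h1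
  · rw [wordExp_stdWord] at h1
    have := eq_stdWord_of_mem_support hd hw
    rw [h1] at this
    exact absurd (this ▸ hlt) (lt_irrefl _)

/-- Modulo the commutation relations, every word is a nonzero multiple of a standard monomial,
up to words with smaller exponent vectors. -/
lemma exists_quotWord_sub_mem (hO : O.IsWell) (hS : IsCommutationSystem S O)
    (hSR : ∀ s ∈ S, s ∈ R) (w : Word n) :
    ∃ k : K, k ≠ 0 ∧ quotWord R w - k • quotWord R (stdWord (wordExp w)) ∈
      expSpan R fun β => O.order.lt ⟨β, ()⟩ ⟨wordExp w, ()⟩ := by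
  induction w using hO.wellFounded_specialOrder.induction with
  | _ w ih =>
    by_cases hw : w = stdWord (wordExp w)
    · refine ⟨1, one_ne_zero, ?_⟩
      rw [← hw, one_smul, sub_self]
      exact zero_mem _
    · obtain ⟨m, m', i, j, hij, rfl⟩ := exists_descent hw
      obtain ⟨⟨c, d, hcd, rfl⟩, -⟩ := hS
      obtain ⟨hc, hd, hlm, hlt⟩ := hcd i j hij
      have hexp : wordExp (m * (FreeMonoid.of i * FreeMonoid.of j) * m') =
          wordExp (m * (FreeMonoid.of j * FreeMonoid.of i) * m') := by
        simp only [wordExp_mul, add_comm (wordExp (FreeMonoid.of i))]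
      -- Undoing the inversion gives a smaller word with the same exponent vector; each swap
      -- contributes a factor `c i j` and a lower term from `d i j`.
      obtain ⟨k, hk, hkmem⟩ := ih _ (specialOrder_mul_lt O hlt m m')
      rw [hexp] at hkmem
      refine ⟨c i j * k, mul_ne_zero hc hk, ?_⟩
      have hrel : quotWord R (FreeMonoid.of j * FreeMonoid.of i) =
          c i j • quotWord R (FreeMonoid.of i * FreeMonoid.of j) + quot R (d i j) := by
        have h := quot_eq_zero_iff.2 (hSR _ ⟨i, j, hij, rfl⟩)
        rw [map_sub, map_sub, map_smul, sub_sub, sub_eq_zero, map_mul, map_mul] at h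
        rw [quotWord_mul, quotWord_mul]
        exact h
      have hdmem : quotWord R m * quot R (d i j) * quotWord R m' ∈ expSpan R fun β =>
          O.order.lt ⟨β, ()⟩ ⟨wordExp (m * (FreeMonoid.of j * FreeMonoid.of i) * m'), ()⟩ := by
        -- As `x_i x_j` is itself standard, the bound on `lm(d i j)` becomes a strict bound on
        -- exponents.
        rw [of_mul_of_eq_stdWord hij.le] at hlm
        have hd1 : quot R (d i j) ∈ expSpan R _ :=
          Submodule.mem_map_of_mem (expSupported_of_lmW_lt hd hlm)
        rw [← hexp]
        refine mul_quotWord_mem_expSpan (P := fun β => O.order.lt ⟨β, ()⟩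
          ⟨wordExp (m * (FreeMonoid.of i * FreeMonoid.of j)), ()⟩) ?_
          (quotWord_mul_mem_expSpan ?_ hd1)
        · intro α hα
          have := O.shift_lt (wordExp m') _ _ hα
          rw [wordExp_mul _ m']
          simpa only [SMon.shift, add_comm (wordExp m')] using this
        · intro α hα
          have := O.shift_lt (wordExp m) _ _ hα
          rw [wordExp_mul m]
          exact this
      have heq : quotWord R (m * (FreeMonoid.of j * FreeMonoid.of i) * m') =
          c i j • quotWord R (m * (FreeMonoid.of i * FreeMonoid.of j) * m') +
            quotWord R m * quot R (d i j) * quotWord R m' := by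
        rw [quotWord_mul R _ m', quotWord_mul R m, hrel, quotWord_mul R _ m', quotWord_mul R m]
        simp only [mul_add, add_mul, mul_smul_comm, smul_mul_assoc]
      rw [heq, mul_smul, add_sub_right_comm, ← smul_sub]
      exact add_mem (Submodule.smul_mem _ _ hkmem) hdmem

/-- The datum describes only leading exponents of elements of `R ∩ K[x]`, whereas reducibility may
be witnessed by any element of `R`. For a reducible `x^α`, subtracting its irreducible
representative produces a polynomial witness: that representative does not contain `x^α` and has
only exponents `≼ α`. -/
lemma stdWord_mem_redWords_iff (hO : O.IsWell) (hS : IsCommutationSystem S O)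
    (hSR : ∀ s ∈ S, s ∈ R) (α : Fin n → ℕ) :
    stdWord α ∈ redWords O R ↔ α ∈ leadExps O {t | t ∈ R ∧ t ∈ polySub K n} := by
  constructor
  · intro h
    obtain ⟨u, hu, huR, hus⟩ := exists_irr_word R hO (stdWord α)
    refine ⟨stdMon K α - u, ⟨huR, sub_mem (stdMon_mem_polySub α) (irr_le_polySub hS hSR hu)⟩, ?_⟩
    rw [irr_eq_supported, MonoidAlgebra.mem_supported] at hu
    rw [lePoly_eq_coe_iff]
    constructor
    · refine ⟨stdWord α, ?_, wordExp_stdWord α⟩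
      have : u.coeff (stdWord α) = 0 := by
        by_contra h0
        exact hu (Finsupp.mem_support_iff.2 h0) h
      rw [Finsupp.mem_support_iff]
      simp [stdMon, this]
    · intro w hw
      by_cases hwα : w = stdWord α
      · let _ := O.order
        rw [hwα, wordExp_stdWord]
      · have hwu : w ∈ u.coeff.support := by
          rw [Finsupp.mem_support_iff] at hw ⊢
          simpa [stdMon, Ne.symm hwα] using hw
        have := wordExp_le_of_specialOrder_le O (hus hwu)
        rwa [wordExp_stdWord] at this
  · rintro ⟨t, ⟨htR, htp⟩, ht⟩
    have ht0 : t ≠ 0 := by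
      intro h
      rw [(lePoly_eq_bot_iff O t).2 h] at ht
      exact WithBot.bot_ne_coe ht
    refine ⟨t, htR, ht0, ?_⟩
    rw [wordExp_leadWord O ht0, WithBot.coe_inj] at ht
    rw [eq_stdWord_of_mem_support htp (leadWord_spec O ht0).1, ht]

variable {I : Finset (FreeAlg K n)}

lemma IsDatumOf.mem_of_mem (h : IsDatumOf R S I O) : ∀ s ∈ S, s ∈ R := by
  intro s hs
  rw [h.2]
  exact TwoSidedIdeal.subset_span (Or.inr hs)

lemma IsDatumOf.stdWord_mem_redWords_iff (h : IsDatumOf R S I O) (α : Fin n → ℕ) :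
    stdWord α ∈ redWords O R ↔ α ∈ leadIdeal O (I : Set (FreeAlg K n)) := by
  rw [PBW.stdWord_mem_redWords_iff h.1.well h.1.comm h.mem_of_mem, h.1.lead, ← h.2]

/-- Multiplying a witness by a word gives a leading word that need not be standard; the closure
comes instead from the form of `L(I)`. -/
lemma IsDatumOf.stdWord_add_mem_redWords (h : IsDatumOf R S I O) {α : Fin n → ℕ}
    (hα : stdWord α ∈ redWords O R) (β : Fin n → ℕ) : stdWord (β + α) ∈ redWords O R := by
  rw [h.stdWord_mem_redWords_iff] at hα ⊢
  obtain ⟨α', hα', γ, rfl⟩ := hα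
  exact ⟨α', hα', β + γ, by rw [add_assoc]⟩

end Quotient

/-! ## Free modules over PBW-reduction-algebras -/

namespace FreeModuleDatum

variable {K : Type*} [Field K] {n : ℕ} {E : Type*} (D : FreeModuleDatum K n E)

lemma isWell_component (e : E) : (D.ord.component e).IsWell := (D.isDatum e).1.well

lemma isWell : D.ord.IsWell := fun α e => D.isWell_component e α ()

/-- The exponents `α` such that `x^α` is reducible with respect to `(R, ≺_e)`. -/
def Red (μ : SMon n E) : Prop := stdWord μ.exp ∈ redWords (D.ord.component μ.comp) D.R

/-- Initial segments of `≺^E`. -/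
def Lower (P : SMon n E → Prop) : Prop := ∀ μ ν, D.ord.order.le μ ν → P ν → P μ

lemma lower_le (μ : SMon n E) : D.Lower fun ν => D.ord.order.le ν μ := by
  let _ := D.ord.order
  exact fun _ _ h h' => le_trans h h'

lemma lower_lt (μ : SMon n E) : D.Lower fun ν => D.ord.order.lt ν μ := by
  let _ := D.ord.order
  exact fun _ _ h h' => lt_of_le_of_lt h h'

lemma irrAt_le_polySub (e : E) : D.irrAt e ≤ polySub K n :=
  irr_le_polySub (D.isDatum e).1.comm (D.isDatum e).mem_of_mem

lemma mem_irrAt_iff {e : E} {t : FreeAlg K n} :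
    t ∈ D.irrAt e ↔ ∀ w ∈ t.coeff.support, w ∉ redWords (D.ord.component e) D.R := by
  rw [irrAt, irr_eq_supported, MonoidAlgebra.mem_supported]
  rfl

lemma stdMon_mem_irrAt_iff (μ : SMon n E) : stdMon K μ.exp ∈ D.irrAt μ.comp ↔ ¬ D.Red μ := by
  rw [mem_irrAt_iff, Red]
  simp [stdMon]

lemma red_iff (μ : SMon n E) : D.Red μ ↔
    ∃ p ∈ D.I μ.comp, ∃ π : Fin n → ℕ, lePoly (D.ord.component μ.comp) p = (π : WithBot (Fin n → ℕ)) ∧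
      π ≤ μ.exp := by
  rw [Red, (D.isDatum μ.comp).stdWord_mem_redWords_iff]
  constructor
  · rintro ⟨π, ⟨p, hp, hpπ⟩, β, h⟩
    exact ⟨p, hp, π, hpπ, by rw [h]; exact le_add_self⟩
  · rintro ⟨p, hp, π, hpπ, h⟩
    exact ⟨π, ⟨p, hp, hpπ⟩, μ.exp - π, (tsub_add_cancel_of_le h).symm⟩

lemma red_shift {μ : SMon n E} (h : D.Red μ) (γ : Fin n → ℕ) : D.Red (μ.shift γ) :=
  (D.isDatum μ.comp).stdWord_add_mem_redWords h γ

/-! ### The irreducible representative -/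

lemma bijective_toA (e : E) :
    Function.Bijective fun t : D.irrAt e => D.toA (t : FreeAlg K n) := by
  constructor
  · intro s t h
    have h' : quot D.R (s : FreeAlg K n) = quot D.R t := h
    rw [quot_eq_quot_iff] at h'
    exact Subtype.ext (sub_eq_zero.1
      (eq_zero_of_mem_irr (D.ord.component e) D.R (sub_mem s.2 t.2) h'))
  · intro a
    obtain ⟨t, rfl⟩ := quot_surjective D.R a
    obtain ⟨u, hu, huR, -⟩ := exists_irr D.R (D.isWell_component e) (s := Set.univ)
      (fun _ _ _ _ => trivial) (t := t) (fun _ _ => trivial)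
    exact ⟨⟨u, hu⟩, (quot_eq_quot_iff.2 huR).symm⟩

lemma tau_mem_irrAt (e : E) (a : D.A) : D.tau e a ∈ D.irrAt e := Subtype.prop _

lemma quot_tau (e : E) (a : D.A) : quot D.R (D.tau e a) = a :=
  Function.invFun_eq ((D.bijective_toA e).2 a)

lemma tau_eq {e : E} {t : FreeAlg K n} (ht : t ∈ D.irrAt e) : D.tau e (quot D.R t) = t := by
  have := (D.bijective_toA e).1 (a₁ := ⟨_, D.tau_mem_irrAt e (quot D.R t)⟩) (a₂ := ⟨t, ht⟩)
    (D.quot_tau e (quot D.R t))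
  exact congrArg Subtype.val this

/-- The map `τ_e` as a `K`-linear map. -/
def tauLinear (e : E) : D.A →ₗ[K] FreeAlg K n where
  toFun := D.tau e
  map_add' a b := by
    rw [← D.tau_eq (add_mem (D.tau_mem_irrAt e a) (D.tau_mem_irrAt e b)), map_add, quot_tau,
      quot_tau]
  map_smul' c a := by
    rw [RingHom.id_apply, ← D.tau_eq (Submodule.smul_mem _ c (D.tau_mem_irrAt e a)), map_smul,
      quot_tau]

lemma tau_eq_zero_iff {e : E} {a : D.A} : D.tau e a = 0 ↔ a = 0 := by
  constructor
  · intro h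
    rw [← D.quot_tau e a, h, map_zero]
  · rintro rfl
    exact map_zero (D.tauLinear e)

/-- Reducing any representative to the irreducible one introduces no larger words, so membership in
an initial segment may be tested on any representative. -/
lemma tau_mem_expSupported_iff {e : E} {P : SMon n E → Prop} (hP : D.Lower P) {a : D.A} :
    D.tau e a ∈ expSupported K (fun α => P ⟨α, e⟩) ↔ a ∈ expSpan D.R fun α => P ⟨α, e⟩ := by
  constructor
  · intro h
    rw [← D.quot_tau e a]
    exact Submodule.mem_map_of_mem h
  · rintro ⟨t, ht, rfl⟩
    obtain ⟨u, hu, huR, hus⟩ := exists_irr D.R (D.isWell_component e)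
      (s := {w | P ⟨wordExp w, e⟩})
      (fun w hw v hvw => hP _ _ (wordExp_le_of_specialOrder_le (D.ord.component e) hvw) hw) ht
    have : quot D.R t = quot D.R u := quot_eq_quot_iff.2 huR
    change D.tau e (quot D.R t) ∈ _
    rw [this, D.tau_eq hu]
    exact hus

/-- The coefficient of `x^α` in `τ_e(a)`, for `μ = (α, e)`. -/
def coefA (μ : SMon n E) : D.A →ₗ[K] K :=
  Finsupp.lapply (stdWord μ.exp) ∘ₗ (MonoidAlgebra.coeffLinearEquiv K).toLinearMap ∘ₗ
    D.tauLinear μ.comp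

lemma coefA_apply (μ : SMon n E) (a : D.A) :
    D.coefA μ a = (D.tau μ.comp a).coeff (stdWord μ.exp) := rfl

lemma coefA_quotWord {μ : SMon n E} (h : ¬ D.Red μ) :
    D.coefA μ (quotWord D.R (stdWord μ.exp)) = 1 := by
  have h1 : D.tau μ.comp (quotWord D.R (stdWord μ.exp)) = stdMon K μ.exp :=
    D.tau_eq ((D.stdMon_mem_irrAt_iff μ).2 h)
  rw [coefA_apply, h1]
  simp [stdMon]

lemma coefA_eq_zero_of_red {μ : SMon n E} (h : D.Red μ) (a : D.A) : D.coefA μ a = 0 := by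
  by_contra h0
  exact D.mem_irrAt_iff.1 (D.tau_mem_irrAt μ.comp a) _ (Finsupp.mem_support_iff.2 h0) h

lemma coefA_eq_zero_of_mem {μ : SMon n E} {a : D.A}
    (h : a ∈ expSpan D.R fun α => D.ord.order.lt ⟨α, μ.comp⟩ μ) : D.coefA μ a = 0 := by
  by_contra h0
  rw [← D.tau_mem_expSupported_iff (D.lower_lt μ)] at h
  have h1 := h (Finsupp.mem_support_iff.2 h0)
  simp only [Set.mem_ofPred_eq, wordExp_stdWord] at h1
  let _ := D.ord.order
  exact lt_irrefl _ h1

/-- The irreducible representative lies in `K[x]`, so `stdWord μ.exp` is its only possible word with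
exponent `μ.exp`. For reducible `μ` the coefficient is zero and the claim still makes sense. -/
lemma sub_coefA_smul_mem {μ : SMon n E} {a : D.A}
    (h : a ∈ expSpan D.R fun α => D.ord.order.le ⟨α, μ.comp⟩ μ) :
    a - D.coefA μ a • quotWord D.R (stdWord μ.exp) ∈
      expSpan D.R fun α => D.ord.order.lt ⟨α, μ.comp⟩ μ := by
  let _ := D.ord.order
  rw [← D.tau_mem_expSupported_iff (D.lower_le μ)] at h
  have h1 : a - D.coefA μ a • quotWord D.R (stdWord μ.exp) =
      quot D.R (D.tau μ.comp a - D.coefA μ a • MonoidAlgebra.single (stdWord μ.exp) 1) := by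
    rw [map_sub, map_smul, quot_tau, quotWord]
  rw [h1]
  refine Submodule.mem_map_of_mem (f := (quot D.R).toLinearMap) fun w hw => ?_
  have hne : w ≠ stdWord μ.exp := by
    rintro rfl
    exact Finsupp.mem_support_iff.1 hw (by simp [coefA_apply])
  have hw' : w ∈ (D.tau μ.comp a).coeff.support := by
    rw [SetLike.mem_coe, Finsupp.mem_support_iff] at hw
    rw [Finsupp.mem_support_iff]
    simpa [hne.symm] using hw
  refine lt_of_le_of_ne (h hw') fun heq => hne ?_
  rw [eq_stdWord_of_mem_support (D.irrAt_le_polySub _ (D.tau_mem_irrAt _ a)) hw']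
  exact congrArg (fun ν => stdWord (SMon.exp ν)) heq

lemma exists_quotWord_sub_mem (e : E) (w : Word n) :
    ∃ k : K, k ≠ 0 ∧ quotWord D.R w - k • quotWord D.R (stdWord (wordExp w)) ∈
      expSpan D.R fun β => D.ord.order.lt ⟨β, e⟩ ⟨wordExp w, e⟩ :=
  PBW.exists_quotWord_sub_mem (D.isWell_component e) (D.isDatum e).1.comm
    (D.isDatum e).mem_of_mem w

/-- Both words are compared with their common standard word. -/
lemma exists_quotWord_sub_smul_mem (e : E) {w w' : Word n} (h : wordExp w = wordExp w') :
    ∃ k : K, k ≠ 0 ∧ quotWord D.R w - k • quotWord D.R w' ∈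
      expSpan D.R fun β => D.ord.order.lt ⟨β, e⟩ ⟨wordExp w, e⟩ := by
  obtain ⟨k, hk, hkm⟩ := D.exists_quotWord_sub_mem e w
  obtain ⟨k', hk', hkm'⟩ := D.exists_quotWord_sub_mem e w'
  rw [← h] at hkm'
  refine ⟨k * k'⁻¹, mul_ne_zero hk (inv_ne_zero hk'), ?_⟩
  have := sub_mem hkm (Submodule.smul_mem _ (k * k'⁻¹) hkm')
  rw [smul_sub, smul_smul, inv_mul_cancel_right₀ hk'] at this
  simpa using this

/-- Multiplication by a word with exponent vector `γ` maps a leading term at `μ` to one at `γ + μ`,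
provided that the latter is irreducible. -/
lemma coefA_quotWord_mul {μ : SMon n E} {w : Word n} (hred : ¬ D.Red (μ.shift (wordExp w)))
    {a : D.A} (h : a ∈ expSpan D.R fun α => D.ord.order.le ⟨α, μ.comp⟩ μ)
    (ha : D.coefA μ a ≠ 0) : D.coefA (μ.shift (wordExp w)) (quotWord D.R w * a) ≠ 0 := by
  have h1 : quotWord D.R w * (a - D.coefA μ a • quotWord D.R (stdWord μ.exp)) ∈
      expSpan D.R fun α => D.ord.order.lt ⟨α, μ.comp⟩ (μ.shift (wordExp w)) :=
    quotWord_mul_mem_expSpan (fun α hα => D.ord.shift_lt (wordExp w) _ _ hα)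
      (D.sub_coefA_smul_mem h)
  obtain ⟨k, hk, hkm⟩ := D.exists_quotWord_sub_mem μ.comp (w * stdWord μ.exp)
  rw [wordExp_mul, wordExp_stdWord, quotWord_mul] at hkm
  have h2 := D.coefA_eq_zero_of_mem (μ := μ.shift (wordExp w)) h1
  have h3 := D.coefA_eq_zero_of_mem (μ := μ.shift (wordExp w)) hkm
  -- Irreducibility of the shifted monomial enters here: otherwise this coefficient would be zero.
  have h4 : D.coefA (μ.shift (wordExp w)) (quotWord D.R (stdWord (wordExp w + μ.exp))) = 1 :=
    D.coefA_quotWord hred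
  rw [map_sub, map_smul, h4, smul_eq_mul, mul_one, sub_eq_zero] at h3
  rw [mul_sub, mul_smul_comm, map_sub, map_smul, h3, sub_eq_zero] at h2
  rw [h2]
  exact mul_ne_zero ha hk

/-! ### The filtration by extended leading exponents -/

/-- Tuples all of whose components are combinations of words with exponents satisfying `P`. -/
def fil (P : SMon n E → Prop) : Submodule K (E → D.A) :=
  Submodule.pi Set.univ fun e => expSpan D.R fun α => P ⟨α, e⟩

lemma mem_fil_iff {P : SMon n E → Prop} {v : E → D.A} :
    v ∈ D.fil P ↔ ∀ e, v e ∈ expSpan D.R fun α => P ⟨α, e⟩ := by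
  simp [fil, Submodule.mem_pi]

lemma fil_mono {P Q : SMon n E → Prop} (h : ∀ μ, P μ → Q μ) : D.fil P ≤ D.fil Q := by
  intro v hv
  rw [mem_fil_iff] at hv ⊢
  exact fun e => expSpan_mono (fun α => h ⟨α, e⟩) (hv e)

lemma quotWord_smul_mem_fil {P Q : SMon n E → Prop} {w : Word n}
    (h : ∀ μ, P μ → Q (μ.shift (wordExp w))) {v : E → D.A} (hv : v ∈ D.fil P) :
    quotWord D.R w • v ∈ D.fil Q := by
  rw [mem_fil_iff] at hv ⊢
  exact fun e => quotWord_mul_mem_expSpan (fun α hα => h ⟨α, e⟩ hα) (hv e)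

/-- The coefficient of the standard monomial `μ` in `v`. -/
def coef (μ : SMon n E) : (E → D.A) →ₗ[K] K := D.coefA μ ∘ₗ LinearMap.proj μ.comp

lemma coef_apply (μ : SMon n E) (v : E → D.A) : D.coef μ v = D.coefA μ (v μ.comp) := rfl

lemma coef_eq_zero_of_mem_fil {μ : SMon n E} {v : E → D.A}
    (h : v ∈ D.fil fun ν => D.ord.order.lt ν μ) : D.coef μ v = 0 :=
  D.coefA_eq_zero_of_mem (D.mem_fil_iff.1 h μ.comp)

lemma mem_fil_lt_of_coef_eq_zero {μ : SMon n E} {v : E → D.A}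
    (h : v ∈ D.fil fun ν => D.ord.order.le ν μ) (h0 : D.coef μ v = 0) :
    v ∈ D.fil fun ν => D.ord.order.lt ν μ := by
  let _ := D.ord.order
  rw [mem_fil_iff] at h ⊢
  intro e
  by_cases he : e = μ.comp
  · subst he
    have := D.sub_coefA_smul_mem (h μ.comp)
    have h1 : (0 : K) • quotWord D.R (stdWord μ.exp) = 0 :=
      zero_smul K (quotWord D.R (stdWord μ.exp))
    rw [← coef_apply, h0, h1, sub_zero] at this
    exact this
  · refine expSpan_mono (fun α hα => lt_of_le_of_ne hα ?_) (h e)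
    rintro rfl
    exact he rfl

/-- A reducible monomial never occurs in an irreducible representative, so the bound `≼ μ` is
automatically strict. -/
lemma mem_fil_lt_of_red {μ : SMon n E} (hμ : D.Red μ) {v : E → D.A}
    (h : v ∈ D.fil fun ν => D.ord.order.le ν μ) : v ∈ D.fil fun ν => D.ord.order.lt ν μ :=
  D.mem_fil_lt_of_coef_eq_zero h (D.coefA_eq_zero_of_red hμ _)

variable [Fintype E]

lemma lec_eq_bot_iff {v : E → D.A} : D.lec v = ⊥ ↔ v = 0 := by
  rw [lec, lecPoly_eq_bot_iff, funext_iff, funext_iff]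
  exact forall_congr' fun e => D.tau_eq_zero_iff

lemma exists_lec_eq {v : E → D.A} (hv : v ≠ 0) :
    ∃ μ : SMon n E, D.lec v = (μ : WithBot (SMon n E)) := by
  cases h : D.lec v with
  | bot => exact absurd (D.lec_eq_bot_iff.1 h) hv
  | coe μ => exact ⟨μ, rfl⟩

/-- This translates leading data into the filtration and one coefficient functional, both linear, so
that later arguments need not mention `tau`. -/
lemma lec_eq_coe_iff {v : E → D.A} {μ : SMon n E} : D.lec v = (μ : WithBot (SMon n E)) ↔
    (v ∈ D.fil fun ν => D.ord.order.le ν μ) ∧ D.coef μ v ≠ 0 := by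
  rw [lec, lecPoly_eq_coe_iff, and_comm, mem_fil_iff]
  refine and_congr (forall_congr' fun e => D.tau_mem_expSupported_iff (D.lower_le μ)) ?_
  constructor
  · rintro ⟨w, hw, hwμ⟩
    have := eq_stdWord_of_mem_support (D.irrAt_le_polySub _ (D.tau_mem_irrAt _ _)) hw
    rw [hwμ] at this
    subst this
    exact Finsupp.mem_support_iff.1 hw
  · intro h
    exact ⟨stdWord μ.exp, Finsupp.mem_support_iff.2 h, wordExp_stdWord _⟩

lemma mem_fil_iff_of_lec {v : E → D.A} {μ : SMon n E} (h : D.lec v = (μ : WithBot (SMon n E)))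
    {P : SMon n E → Prop} (hP : D.Lower P) : v ∈ D.fil P ↔ P μ := by
  obtain ⟨h1, h2⟩ := D.lec_eq_coe_iff.1 h
  constructor
  · intro hv
    rw [mem_fil_iff] at hv
    have := hv μ.comp
    rw [← D.tau_mem_expSupported_iff hP] at this
    have := this (Finsupp.mem_support_iff.2 h2)
    simpa only [Set.mem_ofPred_eq, wordExp_stdWord] using this
  · intro hμ
    exact D.fil_mono (fun ν hν => hP ν μ hν hμ) h1

lemma not_red_of_lec {v : E → D.A} {μ : SMon n E} (h : D.lec v = (μ : WithBot (SMon n E))) :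
    ¬ D.Red μ := fun hμ => (D.lec_eq_coe_iff.1 h).2 (D.coefA_eq_zero_of_red hμ _)

lemma quotWord_smul_mem_fil_of_lec {v : E → D.A} {μ : SMon n E}
    (h : D.lec v = (μ : WithBot (SMon n E))) (w : Word n) :
    quotWord D.R w • v ∈ D.fil fun ν => D.ord.order.le ν (μ.shift (wordExp w)) :=
  D.quotWord_smul_mem_fil (P := fun ν => D.ord.order.le ν μ)
    (fun ν hν => D.ord.shift_le (wordExp w) (μ := ν) (ν := μ) hν) (D.lec_eq_coe_iff.1 h).1

lemma lec_quotWord_smul {v : E → D.A} {μ : SMon n E}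
    (h : D.lec v = (μ : WithBot (SMon n E))) {w : Word n}
    (hred : ¬ D.Red (μ.shift (wordExp w))) :
    D.lec (quotWord D.R w • v) = (μ.shift (wordExp w) : WithBot (SMon n E)) := by
  obtain ⟨h1, h2⟩ := D.lec_eq_coe_iff.1 h
  exact D.lec_eq_coe_iff.2 ⟨D.quotWord_smul_mem_fil_of_lec h w,
    D.coefA_quotWord_mul hred (D.mem_fil_iff.1 h1 μ.comp) h2⟩

lemma lc_eq_coef {v : E → D.A} {μ : SMon n E} (h : D.lec v = (μ : WithBot (SMon n E))) :
    D.lc v = D.coef μ v := by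
  rw [lc, h]
  rfl

omit [Fintype E] in
lemma monSMul_eq (c : K) (γ : Fin n → ℕ) (v : E → D.A) :
    D.monSMul c γ v = c • quotWord D.R (stdWord γ) • v := by
  have : D.toA (c • stdMon K γ) = c • quotWord D.R (stdWord γ) := map_smul (quot D.R) c _
  rw [monSMul, this, smul_assoc]

end FreeModuleDatum

/-! ## The Buchberger criterion -/

/-- Modulo `W` there is a chain of proportionalities from `y` to `x`, to `x'`, to `y'`; the scalar
is the product of their ratios. -/
lemma exists_sub_smul_mem {K V : Type*} [Field K] [AddCommGroup V] [Module K V]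
    {W : Submodule K V} {x x' y y' : V} {a a' k k' : K} (ha : a ≠ 0) (hk' : k' ≠ 0)
    (hy : y - k • x ∈ W) (hx : a • x - a' • x' ∈ W) (hy' : y' - k' • x' ∈ W) :
    ∃ c : K, y - c • y' ∈ W := by
  refine ⟨k * a⁻¹ * a' * k'⁻¹, ?_⟩
  have := sub_mem (add_mem hy (W.smul_mem (k * a⁻¹) hx)) (W.smul_mem (k * a⁻¹ * a' * k'⁻¹) hy')
  convert this using 1
  match_scalars <;> field_simp <;> ring

namespace FreeModuleDatum

variable {K : Type*} [Field K] {n : ℕ} {E : Type*} (D : FreeModuleDatum K n E)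

lemma add_smul_vec (c d : K) (v : E → D.A) : (c + d) • v = c • v + d • v := add_smul c d v

lemma zero_smul_vec (v : E → D.A) : (0 : K) • v = 0 := zero_smul K v

lemma mul_smul_vec (a b : D.A) (v : E → D.A) : (a * b) • v = a • b • v := mul_smul a b v

variable [Fintype E]

/-- The span of the word multiples `w g` with `g ∈ G` and `wordExp w + lec(g)` satisfying `P`. -/
def repSpan (G : Finset (E → D.A)) (P : SMon n E → Prop) : Submodule K (E → D.A) :=
  Submodule.span K {v | ∃ g ∈ G, ∃ ν : SMon n E, D.lec g = (ν : WithBot (SMon n E)) ∧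
    ∃ w : Word n, P (ν.shift (wordExp w)) ∧ v = quotWord D.R w • g}

variable {D} {G : Finset (E → D.A)}

lemma quotWord_smul_mem_repSpan {P : SMon n E → Prop} {g : E → D.A} (hg : g ∈ G) {ν : SMon n E}
    (hν : D.lec g = (ν : WithBot (SMon n E))) {w : Word n} (h : P (ν.shift (wordExp w))) :
    quotWord D.R w • g ∈ D.repSpan G P :=
  Submodule.subset_span ⟨g, hg, ν, hν, w, h, rfl⟩

lemma repSpan_mono {P Q : SMon n E → Prop} (h : ∀ μ, P μ → Q μ) :
    D.repSpan G P ≤ D.repSpan G Q := by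
  refine Submodule.span_mono ?_
  rintro _ ⟨g, hg, ν, hν, w, hw, rfl⟩
  exact ⟨g, hg, ν, hν, w, h _ hw, rfl⟩

lemma repSpan_le_fil {P : SMon n E → Prop} (hP : D.Lower P) : D.repSpan G P ≤ D.fil P := by
  refine Submodule.span_le.2 ?_
  rintro _ ⟨g, hg, ν, hν, w, hw, rfl⟩
  exact D.fil_mono (fun κ hκ => hP _ _ hκ hw) (D.quotWord_smul_mem_fil_of_lec hν w)

lemma quotWord_smul_repSpan {P Q : SMon n E → Prop} {w : Word n}
    (h : ∀ μ, P μ → Q (μ.shift (wordExp w))) {v : E → D.A} (hv : v ∈ D.repSpan G P) :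
    quotWord D.R w • v ∈ D.repSpan G Q := by
  induction hv using Submodule.span_induction with
  | mem x hx =>
    obtain ⟨g, hg, ν, hν, w', hw', rfl⟩ := hx
    rw [← mul_smul_vec, ← quotWord_mul]
    refine quotWord_smul_mem_repSpan hg hν ?_
    rw [wordExp_mul, ← SMon.shift_shift]
    exact h _ hw'
  | zero => rw [smul_zero]; exact zero_mem _
  | add x y _ _ hx hy => rw [smul_add]; exact add_mem hx hy
  | smul c x _ hx => rw [smul_comm]; exact Submodule.smul_mem _ _ hx

lemma smul_mem_repSpan {P : SMon n E → Prop} {g : E → D.A} (hg : g ∈ G) {ν : SMon n E}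
    (hν : D.lec g = (ν : WithBot (SMon n E))) {a : D.A}
    (ha : a ∈ expSpan D.R fun α => P (ν.shift α)) : a • g ∈ D.repSpan G P := by
  rw [expSpan_eq_span] at ha
  induction ha using Submodule.span_induction with
  | mem x hx =>
    obtain ⟨w, hw, rfl⟩ := hx
    exact quotWord_smul_mem_repSpan hg hν hw
  | zero => rw [zero_smul]; exact zero_mem _
  | add x y _ _ hx hy => rw [add_smul]; exact add_mem hx hy
  | smul c x _ hx => rw [smul_assoc]; exact Submodule.smul_mem _ _ hx

/-- A finite combination has a largest bound. The case `v = 0` is separate because `P` may have no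
solution. -/
lemma exists_mem_repSpan_le {P : SMon n E → Prop} {v : E → D.A} (hv : v ∈ D.repSpan G P) :
    v = 0 ∨ ∃ μ, P μ ∧ v ∈ D.repSpan G fun ν => D.ord.order.le ν μ := by
  let _ := D.ord.order
  induction hv using Submodule.span_induction with
  | mem x hx =>
    obtain ⟨g, hg, ν, hν, w, hw, rfl⟩ := hx
    exact Or.inr ⟨_, hw, quotWord_smul_mem_repSpan hg hν (le_refl (ν.shift (wordExp w)))⟩
  | zero => exact Or.inl rfl
  | add x y _ _ hx hy =>
    rcases hx with rfl | ⟨μ, hμ, hx⟩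
    · rwa [zero_add]
    · rcases hy with rfl | ⟨μ', hμ', hy⟩
      · rw [add_zero]
        exact Or.inr ⟨μ, hμ, hx⟩
      · rcases le_total μ μ' with h | h
        · exact Or.inr ⟨μ', hμ', add_mem (repSpan_mono (fun κ hκ => le_trans hκ h) hx) hy⟩
        · exact Or.inr ⟨μ, hμ, add_mem hx (repSpan_mono (fun κ hκ => le_trans hκ h) hy)⟩
  | smul c x _ hx =>
    rcases hx with rfl | ⟨μ, hμ, hx⟩
    · exact Or.inl (smul_zero c)
    · exact Or.inr ⟨μ, hμ, Submodule.smul_mem _ _ hx⟩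

/-! ### Standard representations -/

omit [Fintype E] in
-- The order condition on a coefficient becomes membership in a `K`-subspace, because the exponents
-- with `γ + α` below `μ` form an initial segment.
lemma le_le_iff {e : E} {a : D.A} {μ : SMon n E} {γ : Fin n → ℕ} :
    D.LecLE ((D.le e a).map fun α => (⟨γ + α, e⟩ : SMon n E)) (μ : WithBot (SMon n E)) ↔
      a ∈ expSpan D.R fun α => D.ord.order.le ⟨γ + α, e⟩ μ := by
  let _ := D.ord.order
  have hP : D.Lower fun κ => D.ord.order.le (κ.shift γ) μ :=
    fun κ κ' h h' => le_trans (D.ord.shift_le γ h) h'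
  have key := D.tau_mem_expSupported_iff (e := e) hP (a := a)
  refine Iff.trans ?_ key
  cases h : D.le e a with
  | bot =>
    rw [FreeModuleDatum.le, lePoly_eq_bot_iff] at h
    rw [h]
    refine ⟨fun _ => zero_mem _, fun _ => ?_⟩
    change (⊥ : WithBot (SMon n E)) ≤ _
    exact bot_le
  | coe α =>
    rw [FreeModuleDatum.le, lePoly_eq_coe_iff] at h
    obtain ⟨⟨w, hw, rfl⟩, hmax⟩ := h
    change ((⟨γ + wordExp w, e⟩ : SMon n E) : WithBot (SMon n E)) ≤ _ ↔ _
    rw [WithBot.coe_le_coe]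
    constructor
    · intro h w' hw'
      exact hP ⟨wordExp w', e⟩ ⟨wordExp w, e⟩ (hmax w' hw') h
    · intro h
      exact h hw

lemma lecLE_leAddLec_iff {g : E → D.A} {ν : SMon n E} (hν : D.lec g = (ν : WithBot (SMon n E)))
    {a : D.A} {μ : SMon n E} : D.LecLE (D.leAddLec a g) (μ : WithBot (SMon n E)) ↔
      a ∈ expSpan D.R fun α => D.ord.order.le (ν.shift α) μ := by
  have h1 : D.leAddLec a g = (D.le ν.comp a).map fun α => (⟨ν.exp + α, ν.comp⟩ : SMon n E) := by
    rw [leAddLec, hν]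
    change (D.le ν.comp a).map (fun α => ν.shift α) = _
    simp only [SMon.shift, add_comm]
  rw [h1, le_le_iff]
  simp only [SMon.shift, add_comm]

lemma lecLE_leAddLec_of_eq_zero {a : D.A} (μ : WithBot (SMon n E)) :
    D.LecLE (D.leAddLec a (0 : E → D.A)) μ := by
  let _ := D.ord.order
  rw [leAddLec, D.lec_eq_bot_iff.2 rfl]
  change (⊥ : WithBot (SMon n E)) ≤ _
  exact bot_le

/-- Representations bounded by a fixed `μ` thus form a subspace spanned by word multiples, which
allows span induction in place of manipulating coefficient families. -/
lemma mem_repSpan_iff {v : E → D.A} {μ : SMon n E} :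
    (v ∈ D.repSpan G fun ν => D.ord.order.le ν μ) ↔
      ∃ h : (E → D.A) → D.A, v = ∑ g ∈ G, h g • g ∧
        ∀ g ∈ G, D.LecLE (D.leAddLec (h g) g) (μ : WithBot (SMon n E)) := by
  classical
  have hlec : ∀ (h : (E → D.A) → D.A), (∀ g ∈ G, D.LecLE (D.leAddLec (h g) g) μ) ↔
      ∀ g ∈ G, ∀ ν : SMon n E, D.lec g = (ν : WithBot (SMon n E)) →
        h g ∈ expSpan D.R fun α => D.ord.order.le (ν.shift α) μ := by
    intro h
    refine forall₂_congr fun g _ => ⟨fun h1 ν hν => (lecLE_leAddLec_iff hν).1 h1, fun h1 => ?_⟩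
    by_cases hg : g = 0
    · rw [hg]
      exact lecLE_leAddLec_of_eq_zero _
    · obtain ⟨ν, hν⟩ := D.exists_lec_eq hg
      exact (lecLE_leAddLec_iff hν).2 (h1 ν hν)
  simp only [hlec]
  constructor
  · intro hv
    induction hv using Submodule.span_induction with
    | mem x hx =>
      obtain ⟨g, hg, ν, hν, w, hw, rfl⟩ := hx
      refine ⟨Pi.single g (quotWord D.R w), ?_, fun g' hg' ν' hν' => ?_⟩
      · rw [Finset.sum_eq_single g]
        · rw [Pi.single_eq_same]
        · intro g' _ hne
          rw [Pi.single_eq_of_ne hne, zero_smul]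
        · exact fun h => absurd hg h
      · by_cases hne : g' = g
        · subst hne
          rw [Pi.single_eq_same]
          rw [hν, WithBot.coe_inj] at hν'
          subst hν'
          exact quotWord_mem_expSpan hw
        · rw [Pi.single_eq_of_ne hne]
          exact zero_mem _
    | zero =>
      exact ⟨0, by simp, fun _ _ _ _ => zero_mem _⟩
    | add x y _ _ hx hy =>
      obtain ⟨h, rfl, h1⟩ := hx
      obtain ⟨h', rfl, h1'⟩ := hy
      refine ⟨h + h', ?_, fun g hg ν hν => add_mem (h1 g hg ν hν) (h1' g hg ν hν)⟩
      simp only [Pi.add_apply, add_smul, Finset.sum_add_distrib]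
    | smul c x _ hx =>
      obtain ⟨h, rfl, h1⟩ := hx
      refine ⟨c • h, ?_, fun g hg ν hν => Submodule.smul_mem _ _ (h1 g hg ν hν)⟩
      rw [Finset.smul_sum]
      exact Finset.sum_congr rfl fun g _ => (smul_assoc c (h g) g).symm
  · rintro ⟨h, rfl, h1⟩
    refine Submodule.sum_mem _ fun g hg => ?_
    by_cases hg0 : g = 0
    · rw [hg0, smul_zero]
      exact zero_mem _
    · obtain ⟨ν, hν⟩ := D.exists_lec_eq hg0
      exact smul_mem_repSpan hg hν (h1 g hg ν hν)

/-- `v` has a standard representation with respect to `G`. -/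
def HasStdRep (G : Finset (E → D.A)) (v : E → D.A) : Prop :=
  ∃ h : (E → D.A) → D.A, v = ∑ g ∈ G, h g • g ∧
    ∀ g ∈ G, D.LecLE (D.leAddLec (h g) g) (D.lec v)

lemma hasStdRep_zero : HasStdRep G (0 : E → D.A) := by
  let _ := D.ord.order
  refine ⟨0, by simp, fun g _ => ?_⟩
  have h0 : D.le = fun e a => lePoly (D.ord.component e) (D.tau e a) := rfl
  have : D.leAddLec ((0 : (E → D.A) → D.A) g) g = ⊥ := by
    rw [leAddLec]
    cases D.lec g with
    | bot => rfl
    | coe ν =>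
      change (D.le ν.comp 0).map (fun α => ν.shift α) = ⊥
      rw [WithBot.map_eq_bot_iff, h0, lePoly_eq_bot_iff, D.tau_eq_zero_iff]
  rw [this]
  change (⊥ : WithBot (SMon n E)) ≤ _
  exact bot_le

lemma hasStdRep_iff {v : E → D.A} {μ : SMon n E} (hμ : D.lec v = (μ : WithBot (SMon n E))) :
    HasStdRep G v ↔ v ∈ D.repSpan G fun ν => D.ord.order.le ν μ := by
  rw [HasStdRep, hμ, mem_repSpan_iff]

/-- A standard representation inherits every upper bound on the element, including strict ones; this
is how hypotheses on s-polynomials are used. -/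
lemma HasStdRep.mem_repSpan {v : E → D.A} (h : HasStdRep G v) {P : SMon n E → Prop}
    (hP : D.Lower P) (hv : v ∈ D.fil P) : v ∈ D.repSpan G P := by
  by_cases h0 : v = 0
  · rw [h0]
    exact zero_mem _
  · obtain ⟨μ, hμ⟩ := D.exists_lec_eq h0
    rw [hasStdRep_iff hμ] at h
    rw [D.mem_fil_iff_of_lec hμ hP] at hv
    exact repSpan_mono (fun κ hκ => hP _ _ hκ hv) h

lemma hasStdRep_of_isNormalForm_zero {v : E → D.A} (h : D.IsNormalForm G v 0) :
    HasStdRep G v := by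
  rcases h with ⟨rfl, -⟩ | ⟨-, ⟨h, h1, h2⟩, -⟩
  · exact hasStdRep_zero
  · exact ⟨h, by rwa [add_zero] at h1, h2⟩

/-! ### Leading terms in the span of `G` -/

/-- The difference is small as a representation by multiples of `g`, not merely as an element of the
filtration. Hence only exponent vectors matter in top terms. -/
lemma smul_sub_smul_mem_repSpan {g : E → D.A} (hg : g ∈ G) {ν : SMon n E}
    (hν : D.lec g = (ν : WithBot (SMon n E))) {w w' : Word n} (h : wordExp w = wordExp w') :
    ∃ k : K, k ≠ 0 ∧ quotWord D.R w • g - k • quotWord D.R w' • g ∈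
      D.repSpan G fun κ => D.ord.order.lt κ (ν.shift (wordExp w)) := by
  obtain ⟨k, hk, hkm⟩ := D.exists_quotWord_sub_smul_mem ν.comp h
  refine ⟨k, hk, ?_⟩
  have heq : (quotWord D.R w - k • quotWord D.R w') • g =
      quotWord D.R w • g - k • quotWord D.R w' • g := by
    rw [sub_smul, smul_assoc]
  rw [← heq]
  refine smul_mem_repSpan hg hν (expSpan_mono (fun α hα => ?_) hkm)
  have := D.ord.shift_lt ν.exp _ _ hα
  simpa only [SMon.shift, add_comm ν.exp] using this

/-- Some `p ∈ I_e` has `le(p)` dividing the reducible monomial, so `w` agrees in exponent with a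
multiple of the `x^c` of `spoly(g, p) = x^c g`. That s-polynomial has its top monomial reducible, so
its standard representation is strictly lower, and multiplying by the remaining monomial keeps it
so. -/
lemma quotWord_smul_mem_repSpan_of_red
    (hrel : ∀ g ∈ G, ∀ e, D.IsLcomp g e → ∀ p ∈ D.I e, HasStdRep G (D.spolyRel g e p))
    {g : E → D.A} (hg : g ∈ G) {ν : SMon n E} (hν : D.lec g = (ν : WithBot (SMon n E)))
    {w : Word n} (hred : D.Red (ν.shift (wordExp w))) :
    quotWord D.R w • g ∈ D.repSpan G fun κ => D.ord.order.lt κ (ν.shift (wordExp w)) := by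
  obtain ⟨p, hp, π, hπ, hle⟩ := (D.red_iff _).1 hred
  change p ∈ D.I ν.comp at hp
  change lePoly (D.ord.component ν.comp) p = _ at hπ
  change π ≤ wordExp w + ν.exp at hle
  have hspoly := hrel g hg ν.comp ⟨ν.exp, hν⟩ p hp
  set c : Fin n → ℕ := ν.exp ⊔ π - ν.exp with hc
  have hcν : c + ν.exp = ν.exp ⊔ π := tsub_add_cancel_of_le le_sup_left
  have hcw : c ≤ wordExp w := by
    rw [hc, tsub_le_iff_right]
    exact sup_le le_add_self hle
  have heq : D.spolyRel g ν.comp p = quotWord D.R (stdWord c) • g := by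
    rw [spolyRel, hν, hπ]
    refine (if_pos rfl).trans ?_
    rw [monSMul_eq, one_smul]
  rw [heq] at hspoly
  have hfil := D.quotWord_smul_mem_fil_of_lec hν (stdWord c)
  rw [wordExp_stdWord] at hfil
  have hredc : D.Red (ν.shift c) :=
    (D.red_iff _).2 ⟨p, hp, π, hπ, by rw [SMon.shift, hcν]; exact le_sup_right⟩
  -- The reducible top monomial makes the filtration bound strict, and the standard representation
  -- inherits it.
  have hrep := hspoly.mem_repSpan (D.lower_lt _) (D.mem_fil_lt_of_red hredc hfil)
  have hexp : wordExp w = wordExp (stdWord (wordExp w - c) * stdWord c) := by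
    rw [wordExp_mul, wordExp_stdWord, wordExp_stdWord, tsub_add_cancel_of_le hcw]
  have hshift : (ν.shift c).shift (wordExp w - c) = ν.shift (wordExp w) := by
    rw [SMon.shift_shift, tsub_add_cancel_of_le hcw]
  have hrep' := quotWord_smul_repSpan (w := stdWord (wordExp w - c))
    (Q := fun κ => D.ord.order.lt κ (ν.shift (wordExp w))) (fun κ hκ => by
      rw [wordExp_stdWord, ← hshift]
      exact D.ord.shift_lt _ _ _ hκ) hrep
  rw [← mul_smul_vec, ← quotWord_mul] at hrep'
  obtain ⟨k, -, hkm⟩ := smul_sub_smul_mem_repSpan hg hν hexp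
  have := add_mem hkm (Submodule.smul_mem _ k hrep')
  rwa [sub_add_cancel] at this

lemma inv_smul_sub_inv_smul_mem_fil {u v : E → D.A} {μ : SMon n E}
    (hu : D.lec u = (μ : WithBot (SMon n E))) (hv : D.lec v = (μ : WithBot (SMon n E))) :
    (D.coef μ u)⁻¹ • u - (D.coef μ v)⁻¹ • v ∈ D.fil fun ν => D.ord.order.lt ν μ := by
  obtain ⟨hu1, hu2⟩ := D.lec_eq_coe_iff.1 hu
  obtain ⟨hv1, hv2⟩ := D.lec_eq_coe_iff.1 hv
  refine D.mem_fil_lt_of_coef_eq_zero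
    (sub_mem (Submodule.smul_mem _ _ hu1) (Submodule.smul_mem _ _ hv1)) ?_
  rw [map_sub, map_smul, map_smul, smul_eq_mul, smul_eq_mul, inv_mul_cancel₀ hu2,
    inv_mul_cancel₀ hv2, sub_self]

/-- Up to scalars and lower terms, `w g` and `w' g'` are the multiples by `x^(μ - b)` of the two
halves of `spoly(g, g')`, where `b` is the componentwise maximum of the leading exponents. Its
standard representation makes those halves proportional modulo lower multiples. -/
lemma exists_smul_sub_smul_mem_repSpan
    (hspoly : ∀ g ∈ G, ∀ g' ∈ G, HasStdRep G (D.spoly g g'))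
    {g g' : E → D.A} (hg : g ∈ G) (hg' : g' ∈ G) {ν ν' μ : SMon n E}
    (hν : D.lec g = (ν : WithBot (SMon n E))) (hν' : D.lec g' = (ν' : WithBot (SMon n E)))
    {w w' : Word n} (hw : ν.shift (wordExp w) = μ) (hw' : ν'.shift (wordExp w') = μ)
    (hred : ¬ D.Red μ) :
    ∃ k : K, quotWord D.R w • g - k • quotWord D.R w' • g' ∈
      D.repSpan G fun κ => D.ord.order.lt κ μ := by
  have hcomp : ν.comp = ν'.comp := by
    have := congrArg SMon.comp (hw.trans hw'.symm)
    exact this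
  have hμ : wordExp w + ν.exp = μ.exp := congrArg SMon.exp hw
  have hμ' : wordExp w' + ν'.exp = μ.exp := congrArg SMon.exp hw'
  set b : Fin n → ℕ := ν.exp ⊔ ν'.exp with hb
  have hbμ : b ≤ μ.exp := sup_le (hμ ▸ le_add_self) (hμ' ▸ le_add_self)
  have hcb : b - ν.exp + ν.exp = b := tsub_add_cancel_of_le le_sup_left
  have hcb' : b - ν'.exp + ν'.exp = b := tsub_add_cancel_of_le le_sup_right
  have hμcomp : μ.comp = ν.comp := (congrArg SMon.comp hw).symm
  -- Reducibility passes to multiples, so irreducibility of `μ` descends to `b` and the s-polynomial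
  -- is not the default zero.
  have hredb : ¬ D.Red ⟨b, ν.comp⟩ := by
    intro h
    apply hred
    have := D.red_shift h (μ.exp - b)
    rwa [SMon.shift, tsub_add_cancel_of_le hbμ, ← hμcomp] at this
  have hsh : ν.shift (wordExp (stdWord (b - ν.exp))) = ⟨b, ν.comp⟩ := by
    rw [wordExp_stdWord, SMon.shift, hcb]
  have hsh' : ν'.shift (wordExp (stdWord (b - ν'.exp))) = ⟨b, ν.comp⟩ := by
    rw [wordExp_stdWord, SMon.shift, hcb', hcomp]
  have hlec := D.lec_quotWord_smul hν (w := stdWord (b - ν.exp)) (by rwa [hsh])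
  have hlec' := D.lec_quotWord_smul hν' (w := stdWord (b - ν'.exp)) (by rwa [hsh'])
  rw [hsh] at hlec
  rw [hsh'] at hlec'
  set u := quotWord D.R (stdWord (b - ν.exp)) • g with hu
  set u' := quotWord D.R (stdWord (b - ν'.exp)) • g' with hu'
  have hl := D.lec_eq_coe_iff.1 hlec
  have hl' := D.lec_eq_coe_iff.1 hlec'
  have heq : D.spoly g g' = (D.coef ⟨b, ν.comp⟩ u)⁻¹ • u - (D.coef ⟨b, ν.comp⟩ u')⁻¹ • u' := by
    rw [spoly, hν, hν']
    refine (if_pos ⟨hcomp, (D.stdMon_mem_irrAt_iff ⟨b, ν.comp⟩).2 hredb⟩).trans ?_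
    simp only [monSMul_eq, one_smul, ← hb, ← hu, ← hu']
    rw [D.lc_eq_coef hlec, D.lc_eq_coef hlec']
  have hs := hspoly g hg g' hg'
  rw [heq] at hs
  -- The normalised leading terms cancel, so the representation stays strictly below `b`.
  have hrep := hs.mem_repSpan (D.lower_lt _) (inv_smul_sub_inv_smul_mem_fil hlec hlec')
  have hshift : SMon.shift (μ.exp - b) ⟨b, ν.comp⟩ = μ := by
    rw [SMon.shift, tsub_add_cancel_of_le hbμ, ← hμcomp]
  have hrep' := quotWord_smul_repSpan (w := stdWord (μ.exp - b))
    (Q := fun κ => D.ord.order.lt κ μ) (fun κ hκ => by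
      have := D.ord.shift_lt (μ.exp - b) _ _ hκ
      rwa [hshift, ← wordExp_stdWord (μ.exp - b)] at this) hrep
  rw [smul_sub, smul_comm, smul_comm _ (D.coef ⟨b, ν.comp⟩ u')⁻¹, hu, hu', ← mul_smul_vec,
    ← mul_smul_vec, ← quotWord_mul, ← quotWord_mul, ← hu, ← hu'] at hrep'
  have hexp : wordExp w = wordExp (stdWord (μ.exp - b) * stdWord (b - ν.exp)) := by
    rw [wordExp_mul, wordExp_stdWord, wordExp_stdWord]
    refine add_right_cancel (b := ν.exp) ?_
    rw [hμ, add_assoc, hcb, tsub_add_cancel_of_le hbμ]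
  have hexp' : wordExp w' = wordExp (stdWord (μ.exp - b) * stdWord (b - ν'.exp)) := by
    rw [wordExp_mul, wordExp_stdWord, wordExp_stdWord]
    refine add_right_cancel (b := ν'.exp) ?_
    rw [hμ', add_assoc, hcb', tsub_add_cancel_of_le hbμ]
  obtain ⟨k, -, hkm⟩ := smul_sub_smul_mem_repSpan hg hν hexp
  obtain ⟨k', hk', hkm'⟩ := smul_sub_smul_mem_repSpan hg' hν' hexp'
  rw [hw] at hkm
  rw [hw'] at hkm'
  exact exists_sub_smul_mem (inv_ne_zero hl.2) hk' hkm hrep' hkm'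

end FreeModuleDatum

namespace FreeModuleDatum

variable {K : Type*} [Field K] {n : ℕ} {E : Type*} [Fintype E] {D : FreeModuleDatum K n E}
  {G : Finset (E → D.A)}

/-! ### Equivalence of the conditions -/

/-- The heart of the criterion: if the terms at `μ` cancel in the element, they can be removed from
the representation. Only s-polynomials whose top monomial divides `μ` are needed. -/
lemma mem_repSpan_lt
    (hspoly : ∀ g ∈ G, ∀ g' ∈ G, HasStdRep G (D.spoly g g'))
    (hrel : ∀ g ∈ G, ∀ e, D.IsLcomp g e → ∀ p ∈ D.I e, HasStdRep G (D.spolyRel g e p))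
    {μ : SMon n E} {v : E → D.A} (hv : v ∈ D.repSpan G fun ν => D.ord.order.le ν μ)
    (hlt : v ∈ D.fil fun ν => D.ord.order.lt ν μ) :
    v ∈ D.repSpan G fun ν => D.ord.order.lt ν μ := by
  let _ := D.ord.order
  by_cases hred : D.Red μ
  · refine Submodule.span_le.2 ?_ hv
    rintro _ ⟨g, hg, ν, hν, w, hw, rfl⟩
    rcases hw.eq_or_lt with h | h
    · have := quotWord_smul_mem_repSpan_of_red hrel hg hν (w := w) (by rwa [h])
      rw [h] at this
      exact this
    · exact quotWord_smul_mem_repSpan hg hν h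
  by_cases hex : ∃ g ∈ G, ∃ ν : SMon n E, D.lec g = (ν : WithBot (SMon n E)) ∧
      ∃ w : Word n, ν.shift (wordExp w) = μ
  · obtain ⟨g₀, hg₀, ν₀, hν₀, w₀, hw₀⟩ := hex
    have key : ∃ k : K, v - k • quotWord D.R w₀ • g₀ ∈
        D.repSpan G fun ν => D.ord.order.lt ν μ := by
      clear hlt
      induction hv using Submodule.span_induction with
      | mem x hx =>
        obtain ⟨g, hg, ν, hν, w, hw, rfl⟩ := hx
        rcases hw.eq_or_lt with h | h
        · exact exists_smul_sub_smul_mem_repSpan hspoly hg hg₀ hν hν₀ h hw₀ hred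
        · refine ⟨0, ?_⟩
          rw [zero_smul_vec, sub_zero]
          exact quotWord_smul_mem_repSpan hg hν h
      | zero =>
        refine ⟨0, ?_⟩
        rw [zero_smul_vec, sub_zero]
        exact zero_mem _
      | add x y _ _ hx hy =>
        obtain ⟨k, hk⟩ := hx
        obtain ⟨k', hk'⟩ := hy
        refine ⟨k + k', ?_⟩
        rw [add_smul_vec, add_sub_add_comm]
        exact add_mem hk hk'
      | smul c x _ hx =>
        obtain ⟨k, hk⟩ := hx
        refine ⟨c * k, ?_⟩
        rw [← smul_smul, ← smul_sub]
        exact Submodule.smul_mem _ _ hk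
    obtain ⟨k, hk⟩ := key
    have hlec := D.lec_quotWord_smul hν₀ (w := w₀) (by rwa [hw₀])
    rw [hw₀, D.lec_eq_coe_iff] at hlec
    -- Everything but `k w₀ g₀` lies strictly below `μ`, while `w₀ g₀` has a nonzero coefficient
    -- there; hence `k = 0`.
    have h0 := D.coef_eq_zero_of_mem_fil (sub_mem hlt (repSpan_le_fil (D.lower_lt μ) hk))
    rw [sub_sub_cancel, map_smul, smul_eq_mul, mul_eq_zero, or_iff_left hlec.2] at h0
    rwa [h0, zero_smul_vec, sub_zero] at hk
  · refine Submodule.span_le.2 ?_ hv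
    rintro _ ⟨g, hg, ν, hν, w, hw, rfl⟩
    rcases hw.eq_or_lt with h | h
    · exact absurd ⟨g, hg, ν, hν, w, h⟩ hex
    · exact quotWord_smul_mem_repSpan hg hν h

/-- Well-founded induction on the bound, which drops until it equals `lec(v)`. -/
lemma hasStdRep_of_mem_repSpan
    (hspoly : ∀ g ∈ G, ∀ g' ∈ G, HasStdRep G (D.spoly g g'))
    (hrel : ∀ g ∈ G, ∀ e, D.IsLcomp g e → ∀ p ∈ D.I e, HasStdRep G (D.spolyRel g e p))
    {v : E → D.A} {μ : SMon n E} (hv : v ∈ D.repSpan G fun ν => D.ord.order.le ν μ) :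
    HasStdRep G v := by
  let _ := D.ord.order
  induction μ using D.isWell.wellFounded.induction with
  | _ μ ih =>
    by_cases h0 : v = 0
    · rw [h0]
      exact hasStdRep_zero
    obtain ⟨κ, hκ⟩ := D.exists_lec_eq h0
    have hle : κ ≤ μ :=
      (D.mem_fil_iff_of_lec hκ (D.lower_le μ)).1 (repSpan_le_fil (D.lower_le μ) hv)
    rcases hle.eq_or_lt with rfl | hlt
    · exact (hasStdRep_iff hκ).2 hv
    · rcases exists_mem_repSpan_le (mem_repSpan_lt hspoly hrel hv
        ((D.mem_fil_iff_of_lec hκ (D.lower_lt μ)).2 hlt)) with h | ⟨μ', hμ', h⟩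
      · exact absurd h h0
      · exact ih μ' hμ' h

lemma mem_repSpan_of_mem_span {v : E → D.A} (hv : v ∈ Submodule.span D.A (G : Set (E → D.A))) :
    v ∈ D.repSpan G fun _ => True := by
  induction hv using Submodule.span_induction with
  | mem g hg =>
    by_cases h0 : g = 0
    · rw [h0]
      exact zero_mem _
    · obtain ⟨ν, hν⟩ := D.exists_lec_eq h0
      have := quotWord_smul_mem_repSpan (D := D) (P := fun _ => True) hg hν (w := 1) trivial
      rwa [quotWord_one, one_smul] at this
  | zero => exact zero_mem _
  | add x y _ _ hx hy => exact add_mem hx hy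
  | smul a x _ hx =>
    have ha : a ∈ expSpan D.R fun _ => True := by
      obtain ⟨t, rfl⟩ := quot_surjective D.R a
      exact Submodule.mem_map_of_mem (f := (quot D.R).toLinearMap) fun _ _ => trivial
    rw [expSpan_eq_span] at ha
    induction ha using Submodule.span_induction with
    | mem b hb =>
      obtain ⟨w, -, rfl⟩ := hb
      exact quotWord_smul_repSpan (fun _ _ => trivial) hx
    | zero => rw [zero_smul]; exact zero_mem _
    | add b c _ _ hb hc => rw [add_smul]; exact add_mem hb hc
    | smul c b _ hb => rw [smul_assoc]; exact Submodule.smul_mem _ _ hb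

lemma isGroebnerBasis_span
    (hspoly : ∀ g ∈ G, ∀ g' ∈ G, HasStdRep G (D.spoly g g'))
    (hrel : ∀ g ∈ G, ∀ e, D.IsLcomp g e → ∀ p ∈ D.I e, HasStdRep G (D.spolyRel g e p)) :
    D.IsGroebnerBasis G (Submodule.span D.A (G : Set (E → D.A))) := by
  refine ⟨fun g hg => Submodule.subset_span hg, fun m hm => ?_⟩
  rcases exists_mem_repSpan_le (mem_repSpan_of_mem_span hm) with rfl | ⟨μ, -, h⟩
  · exact hasStdRep_zero
  · exact hasStdRep_of_mem_repSpan hspoly hrel h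

/-- If no multiple of an element of `G` reached `μ`, a representation bounded by `μ` would put `v`
strictly below its own leading term. -/
lemma lec_mem_L {v : E → D.A} {μ : SMon n E} (hμ : D.lec v = (μ : WithBot (SMon n E)))
    (hv : HasStdRep G v) : μ ∈ D.L (G : Set (E → D.A)) := by
  let _ := D.ord.order
  rw [hasStdRep_iff hμ] at hv
  by_contra hL
  have hlt : v ∈ D.repSpan G fun ν => D.ord.order.lt ν μ := by
    refine Submodule.span_le.2 ?_ hv
    rintro _ ⟨g, hg, ν, hν, w, hw, rfl⟩
    rcases hw.eq_or_lt with h | h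
    · exact absurd ⟨g, hg, ν, hν, wordExp w, h.symm⟩ hL
    · exact quotWord_smul_mem_repSpan hg hν h
  exact lt_irrefl μ ((D.mem_fil_iff_of_lec hμ (D.lower_lt μ)).1
    (repSpan_le_fil (D.lower_lt μ) hlt))

lemma IsGroebnerBasis.eq_zero_of_isNormalForm
    (hG : D.IsGroebnerBasis G (Submodule.span D.A (G : Set (E → D.A)))) {v r : E → D.A}
    (hv : v ∈ Submodule.span D.A (G : Set (E → D.A))) (hr : D.IsNormalForm G v r) : r = 0 := by
  rcases hr with ⟨-, hr⟩ | ⟨-, ⟨h, hvr, -⟩, hL⟩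
  · exact hr
  · by_contra h0
    have hmem : r ∈ Submodule.span D.A (G : Set (E → D.A)) := by
      have : r = v - ∑ g ∈ G, h g • g := by rw [hvr, add_sub_cancel_left]
      rw [this]
      exact sub_mem hv (Submodule.sum_mem _ fun g hg =>
        Submodule.smul_mem _ _ (Submodule.subset_span hg))
    obtain ⟨μ, hμ⟩ := D.exists_lec_eq h0
    exact hL h0 μ hμ (lec_mem_L hμ (hG.2 r hmem))

/-- Division with remainder: the leading term is cancelled while it lies in `L(G)`. The process may
stop at the first leading term outside `L(G)`, since a normal form constrains only `lec(r)`. -/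
lemma exists_sub_mem_repSpan {v : E → D.A} {μ : SMon n E}
    (hv : D.lec v = (μ : WithBot (SMon n E))) :
    ∃ r, (v - r ∈ D.repSpan G fun ν => D.ord.order.le ν μ) ∧
      (r ≠ 0 → ∀ κ : SMon n E, D.lec r = (κ : WithBot (SMon n E)) →
        κ ∉ D.L (G : Set (E → D.A))) := by
  let _ := D.ord.order
  induction μ using D.isWell.wellFounded.induction generalizing v with
  | _ μ ih =>
    by_cases hL : μ ∈ D.L (G : Set (E → D.A))
    · obtain ⟨g, hg, ν, hν, β, rfl⟩ := hL
      have hexp : wordExp (stdWord β) = β := wordExp_stdWord β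
      -- The monomial `ν.shift β` is the leading one of `v`, hence irreducible, so multiplying `g`
      -- by `x^β` gives exactly this leading exponent.
      have hlec := D.lec_quotWord_smul hν (w := stdWord β)
        (by rw [hexp]; exact D.not_red_of_lec hv)
      have hmem : quotWord D.R (stdWord β) • g ∈
          D.repSpan G fun κ => D.ord.order.le κ (ν.shift β) :=
        quotWord_smul_mem_repSpan hg hν (by rw [hexp])
      rw [hexp] at hlec
      set u := quotWord D.R (stdWord β) • g
      set v' := v - (D.coef (ν.shift β) v * (D.coef (ν.shift β) u)⁻¹) • u with hv'
      have hfil : v' ∈ D.fil fun κ => D.ord.order.lt κ (ν.shift β) := by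
        refine D.mem_fil_lt_of_coef_eq_zero (sub_mem (D.lec_eq_coe_iff.1 hv).1
          (Submodule.smul_mem _ _ (D.lec_eq_coe_iff.1 hlec).1)) ?_
        rw [map_sub, LinearMap.map_smul, smul_eq_mul,
          inv_mul_cancel_right₀ (D.lec_eq_coe_iff.1 hlec).2, sub_self]
      by_cases h0 : v' = 0
      · refine ⟨0, ?_, fun h => absurd rfl h⟩
        rw [hv', sub_eq_zero] at h0
        rw [sub_zero, h0]
        exact Submodule.smul_mem _ _ hmem
      · obtain ⟨κ, hκ⟩ := D.exists_lec_eq h0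
        have hlt : κ < ν.shift β := (D.mem_fil_iff_of_lec hκ (D.lower_lt _)).1 hfil
        obtain ⟨r, hr, hrL⟩ := ih κ hlt hκ
        refine ⟨r, ?_, hrL⟩
        have := add_mem (repSpan_mono (fun _ h => le_trans h hlt.le) hr)
          (Submodule.smul_mem _ (D.coef (ν.shift β) v * (D.coef (ν.shift β) u)⁻¹) hmem)
        rwa [hv', sub_right_comm, sub_add_cancel] at this
    · refine ⟨v, ?_, fun _ κ hκ => ?_⟩
      · rw [sub_self]
        exact zero_mem _
      · rw [hv, WithBot.coe_inj] at hκ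
        rwa [← hκ]

lemma exists_isNormalForm (v : E → D.A) : ∃ r, D.IsNormalForm G v r := by
  by_cases h0 : v = 0
  · exact ⟨0, Or.inl ⟨h0, rfl⟩⟩
  · obtain ⟨μ, hμ⟩ := D.exists_lec_eq h0
    obtain ⟨r, hr, hrL⟩ := exists_sub_mem_repSpan (G := G) hμ
    obtain ⟨h, h1, h2⟩ := mem_repSpan_iff.1 hr
    exact ⟨r, Or.inr ⟨h0, ⟨h, sub_eq_iff_eq_add.1 h1, by rwa [hμ]⟩, hrL⟩⟩

/-! ### S-polynomials belong to the submodule generated by `G`. -/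

omit [Fintype E] in
lemma monSMul_mem_span (c : K) (γ : Fin n → ℕ) {g : E → D.A} (hg : g ∈ G) :
    D.monSMul c γ g ∈ Submodule.span D.A (G : Set (E → D.A)) :=
  Submodule.smul_mem _ _ (Submodule.subset_span hg)

lemma spoly_mem_span {g g' : E → D.A} (hg : g ∈ G) (hg' : g' ∈ G) :
    D.spoly g g' ∈ Submodule.span D.A (G : Set (E → D.A)) := by
  rw [spoly]
  cases D.lec g with
  | bot => exact zero_mem _
  | coe μ =>
    cases D.lec g' with
    | bot => exact zero_mem _
    | coe ν =>
      simp only [WithBot.recBotCoe_coe]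
      split_ifs
      · exact sub_mem (monSMul_mem_span _ _ hg) (monSMul_mem_span _ _ hg')
      · exact zero_mem _

lemma spolyRel_mem_span {g : E → D.A} (hg : g ∈ G) (e : E) (p : FreeAlg K n) :
    D.spolyRel g e p ∈ Submodule.span D.A (G : Set (E → D.A)) := by
  rw [spolyRel]
  cases D.lec g with
  | bot => exact zero_mem _
  | coe μ =>
    cases lePoly (D.ord.component e) p with
    | bot => exact zero_mem _
    | coe π =>
      simp only [WithBot.recBotCoe_coe]
      split_ifs
      · exact monSMul_mem_span _ _ hg
      · exact zero_mem _

end FreeModuleDatum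

end

end PBW

theorem mainTheorem1 {K : Type*} [Field K] {n : ℕ} {E : Type*} [Fintype E]
    (D : PBW.FreeModuleDatum K n E) (G : Finset (E → D.A)) :
    List.TFAE
      [D.IsGroebnerBasis G (Submodule.span D.A (G : Set (E → D.A))),
       (∀ g ∈ G, ∀ g' ∈ G, ∃ r, D.IsNormalForm G (D.spoly g g') r ∧ r = 0) ∧
        (∀ g ∈ G, ∀ e, D.IsLcomp g e → ∀ p ∈ D.I e,
          ∃ r, D.IsNormalForm G (D.spolyRel g e p) r ∧ r = 0),
       (∀ g ∈ G, ∀ g' ∈ G, ∀ r, D.IsNormalForm G (D.spoly g g') r → r = 0) ∧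
        (∀ g ∈ G, ∀ e, D.IsLcomp g e → ∀ p ∈ D.I e,
          ∀ r, D.IsNormalForm G (D.spolyRel g e p) r → r = 0)] := by
  tfae_have 1 → 3 := fun hG =>
    ⟨fun g hg g' hg' r hr =>
      PBW.FreeModuleDatum.IsGroebnerBasis.eq_zero_of_isNormalForm hG
        (PBW.FreeModuleDatum.spoly_mem_span hg hg') hr,
    fun g hg e _ p _ r hr =>
      PBW.FreeModuleDatum.IsGroebnerBasis.eq_zero_of_isNormalForm hG
        (PBW.FreeModuleDatum.spolyRel_mem_span hg e p) hr⟩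
  tfae_have 3 → 2 := fun ⟨h1, h2⟩ =>
    ⟨fun g hg g' hg' =>
      let ⟨r, hr⟩ := PBW.FreeModuleDatum.exists_isNormalForm (D.spoly g g')
      ⟨r, hr, h1 g hg g' hg' r hr⟩,
    fun g hg e he p hp =>
      let ⟨r, hr⟩ := PBW.FreeModuleDatum.exists_isNormalForm (D.spolyRel g e p)
      ⟨r, hr, h2 g hg e he p hp r hr⟩⟩
  tfae_have 2 → 1 := by
    rintro ⟨h1, h2⟩
    refine PBW.FreeModuleDatum.isGroebnerBasis_span (fun g hg g' hg' => ?_)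
      (fun g hg e he p hp => ?_)
    · obtain ⟨r, hr, rfl⟩ := h1 g hg g' hg'
      exact PBW.FreeModuleDatum.hasStdRep_of_isNormalForm_zero hr
    · obtain ⟨r, hr, rfl⟩ := h2 g hg e he p hp
      exact PBW.FreeModuleDatum.hasStdRep_of_isNormalForm_zero hr
  tfae_finish
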